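/- For $a\ge 1$ and $s\ge 0$ put $$\gamma=\frac{|\Gamma(a-is/2)|^2}{\Gamma(a)\Gamma(a-1/2)\Gamma(1/2)},\qquad h(y)=\gamma e^{sy}(\cos^2 y)^{a-1}\ \text{ if } |y|\le \pi/2,\qquad h(y)=0\ \text{ otherwise}$$ (with $0^0=1$), let $m=\arctan\bigl(s/(2(a-1))\bigr)$ if $a>1$ and $m=\pi/2$ if $a=1$ (a mode of $h$), and put $\Delta=e^{sm}(\cos^2 m)^{a-1}$, $\varepsilon=\frac{3}{2\pi^2\sqrt{a^2+(s/2)^2}}$, $$\gamma^*=\frac{(a-\frac12)\bigl(1+(\frac{s}{2a})^2\bigr)^{a-1/2}e^{-s\arctan(s/(2a))}}{\sqrt{\pi/e}\,\bigl(1+\frac1{2a}\bigr)^a\sqrt a},$$ $$\gamma^+=\frac{\gamma^*(1+\varepsilon)^2}{\sqrt{1+\frac1{6a}}\sqrt{1+\frac1{6(a+1/2)}}},\qquad \gamma^-=\frac{\gamma^*(1-\varepsilon)^2}{\sqrt{1+\frac{0.177}{a}}\sqrt{1+\frac{0.177}{a+1/2}}}.$$ For $L>0$ the universal log-concave rejection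 algorithm for $h$ repeats the following iteration, each time with fresh independent randomness, until it accepts: let $V$ be uniform on $[-2,2]$ and, independently, $U$ uniform on $[0,1]$; if $V<-1$ replace $V$ by $-1+\log(V+2)$, and if $V>1$ replace $V$ by $1-\log(V-1)$; put $Y=m+V/L$; accept (and return $Y$) if $U\min(1,e^{1-L|Y-m|})\le h(Y)/h(m)$. Then, for all $a\ge1$ and $s\ge0$: 1. $0<\gamma^-\le\gamma\le\gamma^+$ and $\Delta=h(m)/\gamma$. With $L=h(m)$ the expected number of iterations is $4$. 2. For $L=\gamma^-\Delta=\gamma^- e^{sm}(\cos^2 m)^{a-1}$ we have $0<L\le h(m)$ and $h(x)\le\min\bigl(h(m),h(m)e^{1-L|x-m|}\bigr)$ for all real $x$. With this $L$ the expected number of iterations is the integral over $\mathbb R$ of this bounding function, which equals $4\gamma/\gamma^-$, and $$4\frac{\gamma}{\gamma^-}\le 4\frac{\gamma^+}{\gamma^-}\le 4\left(\frac{1+\varepsilon}{1-\varepsilon}\right)^2\sqrt{\frac{(a+0.177)(a+0.677)}{(a+1/6)(a+2/3)}}\le C,\qquad C=4\left(\frac{2\pi^2+3}{2\pi^2-3}\right)^2\sqrt{\frac{1.177\times1.677\times18}{35}}.$$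 Here $C\approx7.44$ (that is, $|C-7.44|<0.005$). Moreover, with $L=\gamma^-\Delta$, the expected number of iterations tends to $4$ as $a\to\infty$, uniformly in $s\ge0$. -/

import Mathlib

open MeasureTheory ProbabilityTheory Filter
open scoped ENNReal

noncomputable section

namespace PearsonIV

/-- The normalization constant `γ` of the Pearson IV density with parameters `a`, `s`. -/
def gammaConst (a s : ℝ) : ℝ :=
  ‖Complex.Gamma ((a : ℂ) - Complex.I * (s : ℂ) / 2)‖ ^ 2 /
    (Real.Gamma a * Real.Gamma (a - 1 / 2) * Real.Gamma (1 / 2))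

/-- The arctan-mapped Pearson IV density `h` on `[-π/2, π/2]`.
At `a = 1` and `y = ±π/2` the last factor is `0 ^ 0 = 1`. -/
def h (a s y : ℝ) : ℝ :=
  if |y| ≤ Real.pi / 2 then
    gammaConst a s * Real.exp (s * y) * (Real.cos y ^ 2) ^ (a - 1)
  else 0

/-- The mode `m = arctan (s / (2 (a - 1)))` of `h`, with `m = π/2` when `a = 1`. -/
def mode (a s : ℝ) : ℝ :=
  if a = 1 then Real.pi / 2 else Real.arctan (s / (2 * (a - 1)))

/-- `Δ = e^{sm} (cos² m)^{a-1}`. -/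
def delta (a s : ℝ) : ℝ :=
  Real.exp (s * mode a s) * (Real.cos (mode a s) ^ 2) ^ (a - 1)

/-- The Stirling-type approximation `γ*` of `γ`. -/
def gammaStar (a s : ℝ) : ℝ :=
  (a - 1 / 2) * (1 + (s / (2 * a)) ^ 2) ^ (a - 1 / 2) *
      Real.exp (-s * Real.arctan (s / (2 * a))) /
    (Real.sqrt (Real.pi / Real.exp 1) * (1 + 1 / (2 * a)) ^ a * Real.sqrt a)

/-- The error term `3 / (2 π² √(a² + (s/2)²))`. -/
def err (a s : ℝ) : ℝ :=
  3 / (2 * Real.pi ^ 2 * Real.sqrt (a ^ 2 + (s / 2) ^ 2))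

/-- The explicit upper bound `γ⁺`. -/
def gammaUpper (a s : ℝ) : ℝ :=
  gammaStar a s * ((1 + err a s) ^ 2 /
    (Real.sqrt (1 + 1 / (6 * a)) * Real.sqrt (1 + 1 / (6 * (a + 1 / 2)))))

/-- The explicit lower bound `γ⁻`. -/
def gammaLower (a s : ℝ) : ℝ :=
  gammaStar a s * ((1 - err a s) ^ 2 /
    (Real.sqrt (1 + 0.177 / a) * Real.sqrt (1 + 0.177 / (a + 1 / 2))))

/-- The choice `L = γ⁻ Δ`. -/
def chosenL (a s : ℝ) : ℝ := gammaLower a s * delta a s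

/-! The rejection algorithm, for a function `f`, a point `m` and a number `L`. -/

/-- The replacement of `V` in the algorithm. -/
def transformV (v : ℝ) : ℝ :=
  if v < -1 then -1 + Real.log (v + 2)
  else if 1 < v then 1 - Real.log (v - 1)
  else v

/-- The proposal `Y = m + V / L`, computed from the uniform variate `v`. -/
def proposal (m L v : ℝ) : ℝ := m + transformV v / L

/-- The acceptance test (the `until` condition of the loop) for the pair `p = (V, U)`. -/
def Accepts (f : ℝ → ℝ) (m L : ℝ) (p : ℝ × ℝ) : Prop :=
  p.2 * min 1 (Real.exp (1 - L * |proposal m L p.1 - m|)) ≤ f (proposal m L p.1) / f m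

/-- The randomness used in one iteration: `V` uniform on `[-2, 2]` and, independently, `U` uniform
on `[0, 1]`. -/
def iterationLaw : Measure (ℝ × ℝ) :=
  (cond volume (Set.Icc (-2 : ℝ) 2)).prod (cond volume (Set.Icc (0 : ℝ) 1))

instance : IsProbabilityMeasure iterationLaw := by
  have : IsProbabilityMeasure (cond volume (Set.Icc (-2 : ℝ) 2)) :=
    cond_isProbabilityMeasure_of_finite (by simp) (by simp)
  have : IsProbabilityMeasure (cond volume (Set.Icc (0 : ℝ) 1)) :=
    cond_isProbabilityMeasure_of_finite (by simp) (by simp)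
  unfold iterationLaw
  infer_instance

/-- The number of iterations of the loop when iteration `n + 1` uses the pair `ω n = (V, U)`:
the index of the first accepted iteration, and `∞` if no iteration accepts. -/
def iterations (f : ℝ → ℝ) (m L : ℝ) (ω : ℕ → ℝ × ℝ) : ℝ≥0∞ :=
  ⨅ (n : ℕ) (_ : Accepts f m L (ω n)), ((n : ℝ≥0∞) + 1)

/-- The expected number of iterations, the iterations using independent randomness. -/
def expectedIterations (f : ℝ → ℝ) (m L : ℝ) : ℝ≥0∞ :=
  ∫⁻ ω, iterations f m L ω ∂(Measure.infinitePi fun _ : ℕ => iterationLaw)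

/-- The bounding function `min (f m) (f m * exp (1 - L |x - m|))`. -/
def bounding (f : ℝ → ℝ) (m L x : ℝ) : ℝ :=
  min (f m) (f m * Real.exp (1 - L * |x - m|))

/-- The explicit bound for the expected number of iterations, as a function of `a` and `s`. -/
def explicitBound (a s : ℝ) : ℝ :=
  4 * ((1 + err a s) / (1 - err a s)) ^ 2 *
    Real.sqrt ((a + 0.177) * (a + 0.677) / ((a + 1 / 6) * (a + 2 / 3)))

/-- The explicit uniform bound for the expected number of iterations. -/
def uniformBound : ℝ :=
  4 * ((2 * Real.pi ^ 2 + 3) / (2 * Real.pi ^ 2 - 3)) ^ 2 *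
    Real.sqrt (1.177 * 1.677 * 18 / 35)

end PearsonIV

end

/-! Two facts carry the theorem: `h` is a log-concave probability density with mode `m`, and `γ` can
be enclosed by an explicit form of Stirling's formula.

Bounds on `γ`. Write log|Γ(z)| as Stirling's main term plus a remainder. The main terms of the three
Gamma factors combine exactly to log `γ*` (`log_gammaConst`), so only remainders have to be bounded.
The remainder tends to 0 along z + n, hence it is the sum of its one-step differences, and a bound
on one step by a telescoping expression bounds the remainder itself (`le_of_sub_succ_le`). For
complex z this gives |rem| ≤ 0.13/|z|, which produces `err`; on the real axis sharper two-sided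
bounds produce the constants 1/6 and 0.177.

Normalization. Integration by parts relates the exponents q and q - 2 of the integral of e^{sy}
cos^q y, and the functional equation of Γ matches it, so the mass of `h` is unchanged under a ↦ a +
1. As a → ∞ the dependence on s disappears, and at s = 0 the mass is a beta integral equal to 1
(`mass_eq_one`).

Rejection. A log-concave density f with mode m satisfies f(x) ≤ f(m) e^{1 - f(m)|x - m|}
(`le_mul_exp_of_log_concave`), and decreasing L only weakens the bound. The variate V/L after
replacement has density proportional to the envelope, so one iteration accepts with probability L/(4
f(m)); the number of iterations is geometric with mean 4 f(m)/L (`expectedIterations_eq`). For L =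
`γ⁻`Δ this mean is 4γ/`γ⁻`, and the enclosure of γ yields the explicit bounds. The limit is uniform
in s because `err` is at most a constant over a. -/

noncomputable section

namespace PearsonIV

open Topology

/-! ### Stirling's formula for the modulus of the complex Gamma function -/

/-- The main term of Stirling's approximation of `log ‖Γ z‖`. -/
def stirlingMain (z : ℂ) : ℝ :=
  ((z - 1 / 2) * Complex.log z - z).re + Real.log (2 * Real.pi) / 2

/-- The remainder of Stirling's approximation of `log ‖Γ z‖`. -/
def stirlingRem (z : ℂ) : ℝ := Real.log ‖Complex.Gamma z‖ - stirlingMain z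

lemma ne_zero_of_re_pos {z : ℂ} (hz : 0 < z.re) : z ≠ 0 := by
  rintro rfl; simp at hz

lemma Gamma_add_nat_succ {z : ℂ} (hz : 0 < z.re) (n : ℕ) :
    Complex.Gamma (z + (n + 1)) = Complex.Gamma z * ∏ j ∈ Finset.range (n + 1), (z + j) := by
  induction n with
  | zero => simp [Complex.Gamma_add_one z (ne_zero_of_re_pos hz), mul_comm]
  | succ n ih =>
    have h0 : z + (n + 1 : ℂ) ≠ 0 := ne_zero_of_re_pos (by simp; positivity)
    rw [Finset.prod_range_succ, ← mul_assoc, ← ih]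
    push_cast
    rw [← add_assoc z (n + 1 : ℂ) 1, Complex.Gamma_add_one _ h0, mul_comm]

/-- Euler's limit formula read backwards. The growth rate depends on z only through its real part,
which is reused later to show that the influence of s on `gammaConst` vanishes as a → ∞. -/
lemma tendsto_Gamma_add_nat_div {z : ℂ} (hz : 0 < z.re) :
    Tendsto (fun n : ℕ => ‖Complex.Gamma (z + (n + 1))‖ / ((n : ℝ) ^ z.re * n.factorial))
      atTop (𝓝 1) := by
  have hG : Complex.Gamma z ≠ 0 := Complex.Gamma_ne_zero_of_re_pos hz
  have h1 : Tendsto (fun n : ℕ => ‖Complex.Gamma z / Complex.GammaSeq z n‖) atTop (𝓝 1) := by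
    have := ((tendsto_const_nhds (x := Complex.Gamma z)).div
      (Complex.GammaSeq_tendsto_Gamma z) hG).norm
    rwa [div_self hG, norm_one] at this
  refine h1.congr' ?_
  filter_upwards [eventually_gt_atTop 0] with n hn
  have hn' : (0 : ℝ) < n := by exact_mod_cast hn
  rw [Gamma_add_nat_succ hz, Complex.GammaSeq, norm_div, norm_div, norm_mul, norm_mul,
    Complex.norm_natCast, ← Complex.norm_cpow_eq_rpow_re_of_pos hn', div_div_eq_mul_div,
    Complex.ofReal_natCast]

lemma tendsto_log_Gamma_add_nat_sub {z : ℂ} (hz : 0 < z.re) :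
    Tendsto (fun n : ℕ => Real.log ‖Complex.Gamma (z + (n + 1))‖ -
      (z.re * Real.log n + Real.log n.factorial)) atTop (𝓝 0) := by
  have h1 := (tendsto_Gamma_add_nat_div hz).log one_ne_zero
  rw [Real.log_one] at h1
  refine h1.congr' ?_
  filter_upwards [eventually_gt_atTop 0] with n hn
  have hn' : (0 : ℝ) < n := by exact_mod_cast hn
  have h2 : Complex.Gamma (z + (n + 1)) ≠ 0 :=
    Complex.Gamma_ne_zero_of_re_pos (by simp; positivity)
  rw [Real.log_div (by simpa using h2) (by positivity), Real.log_mul (by positivity)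
    (by positivity), Real.log_rpow hn']

/-- Factoring n out of z + n + 1 isolates the growth of log|Γ(z + n + 1)|. Both other terms tend to
0: the first because n log(1 + (z + 1)/n) → z + 1, the second because `stirlingSeq` tends to √π. -/
lemma stirlingMain_add_nat {z : ℂ} (hz : 0 < z.re) {n : ℕ} (hn : 0 < n) :
    stirlingMain (z + (n + 1)) = (z.re * Real.log n + Real.log n.factorial) +
      ((n * Complex.log (1 + (z + 1) / n)) + (z + 1 / 2) * Complex.log (1 + (z + 1) / n)
        - (z + 1)).re + (Real.log Real.pi / 2 - Real.log (Stirling.stirlingSeq n)) := by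
  have hn' : (0 : ℝ) < n := by exact_mod_cast hn
  have hnc : (n : ℂ) ≠ 0 := by exact_mod_cast hn.ne'
  have h1 : z + (n + 1) = (n : ℝ) * (1 + (z + 1) / n) := by
    push_cast; field_simp; ring
  have h2 : 1 + (z + 1) / n ≠ 0 := by
    apply ne_zero_of_re_pos
    rw [Complex.add_re, Complex.div_natCast_re]; simp; positivity
  have h3 : Complex.log (z + (n + 1)) = Real.log n + Complex.log (1 + (z + 1) / n) := by
    rw [h1, Complex.log_ofReal_mul hn' h2]
  rw [Stirling.log_stirlingSeq_formula, Real.log_div hn'.ne' (Real.exp_pos 1).ne', Real.log_exp,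
    Real.log_mul two_ne_zero hn'.ne', stirlingMain, h3,
    Real.log_mul two_ne_zero Real.pi_pos.ne']
  have h4 : (z + (n + 1) - 1 / 2) * ((Real.log n : ℂ) + Complex.log (1 + (z + 1) / n)) -
      (z + (n + 1)) = ((n * Complex.log (1 + (z + 1) / n)) + (z + 1 / 2) *
      Complex.log (1 + (z + 1) / n) - (z + 1)) + z * (Real.log n : ℂ) +
      (((n + 1 / 2) * Real.log n - n : ℝ) : ℂ) := by
    push_cast; ring
  rw [h4, Complex.add_re, Complex.add_re, Complex.ofReal_re, Complex.re_mul_ofReal]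
  ring

lemma tendsto_stirlingRem_add_nat {z : ℂ} (hz : 0 < z.re) :
    Tendsto (fun n : ℕ => stirlingRem (z + n)) atTop (𝓝 0) := by
  rw [← tendsto_add_atTop_iff_nat 1]
  have hg : Tendsto (fun n : ℕ => (n : ℂ) * ((z + 1) / n)) atTop (𝓝 (z + 1)) := by
    refine tendsto_const_nhds.congr' ?_
    filter_upwards [eventually_gt_atTop 0] with n hn
    have hnc : (n : ℂ) ≠ 0 := by exact_mod_cast hn.ne'
    field_simp
  have hg0 : Tendsto (fun n : ℕ => (z + 1) / (n : ℂ)) atTop (𝓝 0) :=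
    tendsto_const_div_atTop_nhds_zero_nat (𝕜 := ℂ) (z + 1)
  have h1 := Complex.tendsto_nat_mul_log_one_add_of_tendsto hg
  have h2 : Tendsto (fun n : ℕ => Complex.log (1 + (z + 1) / n)) atTop (𝓝 0) := by
    have h := (hg0.const_add 1).clog (by simp)
    simpa using h
  have h3 := ((Complex.continuous_re.tendsto _).comp
    ((h1.add (h2.const_mul (z + 1 / 2))).sub_const (z + 1)))
  have h4 : Tendsto (fun n : ℕ => Real.log Real.pi / 2 - Real.log (Stirling.stirlingSeq n))
      atTop (𝓝 0) := by
    have h := (Stirling.tendsto_stirlingSeq_sqrt_pi.log (by positivity)).const_sub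
      (Real.log Real.pi / 2)
    rwa [Real.log_sqrt Real.pi_pos.le, sub_self] at h
  have h5 := ((tendsto_log_Gamma_add_nat_sub hz).sub h3).sub h4
  simp only [mul_zero, add_zero, sub_self, Complex.zero_re] at h5
  refine h5.congr' ?_
  filter_upwards [eventually_gt_atTop 0] with n hn
  have h6 := stirlingMain_add_nat hz hn
  push_cast
  rw [stirlingRem, h6]
  simp only [Function.comp_apply]
  ring

lemma stirlingRem_sub_add_one {z : ℂ} (hz : 0 < z.re) :
    stirlingRem z - stirlingRem (z + 1) =
      ((z + 1 / 2) * (Complex.log (z + 1) - Complex.log z) - 1).re := by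
  have h0 := ne_zero_of_re_pos hz
  have h1 : Complex.Gamma z ≠ 0 := Complex.Gamma_ne_zero_of_re_pos hz
  have h2 : Real.log ‖Complex.Gamma (z + 1)‖ = (Complex.log z).re +
      Real.log ‖Complex.Gamma z‖ := by
    rw [Complex.Gamma_add_one z h0, norm_mul, Real.log_mul (by simpa) (by simpa), Complex.log_re]
  rw [stirlingRem, stirlingRem, stirlingMain, stirlingMain, h2]
  have h3 : ((z + 1 / 2) * (Complex.log (z + 1) - Complex.log z) - 1).re =
      ((z + 1 - 1 / 2) * Complex.log (z + 1) - (z + 1)).re -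
        ((z - 1 / 2) * Complex.log z - z).re - (Complex.log z).re := by
    rw [← Complex.sub_re, ← Complex.sub_re]
    congr 1
    ring
  rw [h3]
  ring

/-- Telescoping comparison of two null sequences. -/
lemma le_of_sub_succ_le {u b : ℕ → ℝ} (hu : Tendsto u atTop (𝓝 0)) (hb : Tendsto b atTop (𝓝 0))
    (h : ∀ n, u n - u (n + 1) ≤ b n - b (n + 1)) : u 0 ≤ b 0 := by
  have hm : Monotone fun n => u n - b n :=
    monotone_nat_of_le_succ fun n => by linarith [h n]
  have := hm.ge_of_tendsto (by simpa using hu.sub hb) 0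
  linarith

/-- With w = 1/(2z + 1) one has 2(z + 1) = (1 + w)(2z + 1) and 2z = (1 - w)(2z + 1). All factors lie
in the right half-plane, where arguments add without wrapping. The resulting expansion is odd in w,
which gains an order of accuracy. -/
lemma log_add_one_sub_log {z : ℂ} (hz : 0 < z.re) :
    Complex.log (z + 1) - Complex.log z =
      Complex.log (1 + 1 / (2 * z + 1)) - Complex.log (1 + -(1 / (2 * z + 1))) := by
  have key : ∀ x y : ℂ, 0 < x.re → 0 < y.re →
      Complex.log (x * y) = Complex.log x + Complex.log y := by
    intro x y hx hy
    have h1 := abs_lt.mp (Complex.abs_arg_lt_pi_div_two_iff.mpr (Or.inl hx))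
    have h2 := abs_lt.mp (Complex.abs_arg_lt_pi_div_two_iff.mpr (Or.inl hy))
    refine Complex.log_mul (ne_zero_of_re_pos hx) (ne_zero_of_re_pos hy) ⟨?_, ?_⟩ <;> linarith
  have hw : 0 < (2 * z + 1).re := by simp; positivity
  have hw0 := ne_zero_of_re_pos hw
  have hre : |(1 / (2 * z + 1)).re| < 1 := by
    refine (Complex.abs_re_le_norm _).trans_lt ?_
    rw [norm_div, norm_one, div_lt_one (by simpa using hw0)]
    refine lt_of_lt_of_le ?_ (Complex.re_le_norm _)
    simp [hz]
  have h1 : Complex.log (((2 : ℝ) : ℂ) * (z + 1)) =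
      Complex.log (1 + 1 / (2 * z + 1)) + Complex.log (2 * z + 1) := by
    rw [← key _ _ (by rw [Complex.add_re, Complex.one_re]; linarith [(abs_lt.mp hre).1]) hw]
    congr 1
    push_cast
    field_simp; ring
  have h2 : Complex.log (((2 : ℝ) : ℂ) * z) =
      Complex.log (1 + -(1 / (2 * z + 1))) + Complex.log (2 * z + 1) := by
    rw [← key _ _ (by rw [Complex.add_re, Complex.one_re, Complex.neg_re]
                      linarith [(abs_lt.mp hre).2]) hw]
    congr 1
    push_cast
    field_simp; ring
  rw [Complex.log_ofReal_mul two_pos (ne_zero_of_re_pos (by simp; positivity))] at h1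
  rw [Complex.log_ofReal_mul two_pos (ne_zero_of_re_pos hz)] at h2
  linear_combination h1 - h2

lemma norm_log_sub_log_sub_le {w : ℂ} (hw : ‖w‖ ≤ 1 / 3) :
    ‖Complex.log (1 + w) - Complex.log (1 + -w) - (2 * w + 2 / 3 * w ^ 3)‖ ≤
      3 / 5 * ‖w‖ ^ 5 := by
  have hT : ∀ v : ℂ, Complex.logTaylor (4 + 1) v = v - v ^ 2 / 2 + v ^ 3 / 3 - v ^ 4 / 4 := by
    intro v
    simp [Complex.logTaylor, Finset.sum_range_succ]
    ring
  have h1 := Complex.norm_log_sub_logTaylor_le 4 (z := w) (by linarith)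
  have h2 := Complex.norm_log_sub_logTaylor_le 4 (z := -w) (by rw [norm_neg]; linarith)
  rw [hT] at h1 h2
  rw [norm_neg] at h2
  -- Here 3/10 = (3/2)/5, as ‖w‖ ≤ 1/3; the two Taylor errors together give 3/5.
  have h3 : ‖w‖ ^ (4 + 1) * (1 - ‖w‖)⁻¹ / ((4 : ℕ) + 1) ≤ 3 / 10 * ‖w‖ ^ 5 := by
    have : (1 - ‖w‖)⁻¹ ≤ 3 / 2 := by
      rw [inv_le_comm₀ (by linarith) (by norm_num)]; linarith
    have h5 : 0 ≤ ‖w‖ ^ 5 := by positivity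
    norm_num
    nlinarith
  have h4 : Complex.log (1 + w) - Complex.log (1 + -w) - (2 * w + 2 / 3 * w ^ 3) =
      (Complex.log (1 + w) - (w - w ^ 2 / 2 + w ^ 3 / 3 - w ^ 4 / 4)) -
      (Complex.log (1 + -w) - (-w - (-w) ^ 2 / 2 + (-w) ^ 3 / 3 - (-w) ^ 4 / 4)) := by ring
  rw [h4]
  refine (norm_sub_le _ _).trans ?_
  linarith

lemma norm_le_norm_add_ofReal {z : ℂ} (hz : 0 ≤ z.re) {t : ℝ} (ht : 0 ≤ t) :
    ‖z‖ ≤ ‖z + t‖ := by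
  rw [Complex.norm_def, Complex.norm_def]
  apply Real.sqrt_le_sqrt
  simp only [Complex.normSq_apply, Complex.add_re, Complex.add_im, Complex.ofReal_re,
    Complex.ofReal_im, add_zero]
  nlinarith [mul_nonneg hz ht]

/-- The term 1/(12z) of the Stirling series telescopes exactly and is subtracted. What is left has
order |z|⁻⁴, and is bounded in a form that telescopes in the real part once the factor 1/‖z‖ is
frozen. -/
lemma norm_stirling_step_le {z : ℂ} (hz : 1 ≤ z.re) :
    ‖(z + 1 / 2) * (Complex.log (z + 1) - Complex.log z) - 1 -
      (1 / (12 * z) - 1 / (12 * (z + 1)))‖ ≤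
      23 / 1000 / ‖z‖ * (1 / z.re - 1 / (z.re + 1)) := by
  have hz0 : 0 < z.re := by linarith
  have hzne := ne_zero_of_re_pos hz0
  have hz1 : z + 1 ≠ 0 := ne_zero_of_re_pos (by simp; positivity)
  have hz2 : z + 1 / 2 ≠ 0 := ne_zero_of_re_pos (by simp; positivity)
  have hz3 : 2 * z + 1 ≠ 0 := ne_zero_of_re_pos (by simp; positivity)
  set w : ℂ := 1 / (2 * z + 1) with hw
  have hre2 : z.re + 1 / 2 ≤ ‖z + 1 / 2‖ := by
    refine le_trans (le_of_eq ?_) (Complex.re_le_norm _); simp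
  have hre1 : z.re + 1 ≤ ‖z + 1‖ := by
    refine le_trans (le_of_eq ?_) (Complex.re_le_norm _); simp
  have hn2 : ‖z‖ ≤ ‖z + 1 / 2‖ := by
    have := norm_le_norm_add_ofReal hz0.le (t := 1 / 2) (by norm_num)
    simpa using this
  have hwn : ‖w‖ = 1 / (2 * ‖z + 1 / 2‖) := by
    rw [hw, norm_div, norm_one, show 2 * z + 1 = 2 * (z + 1 / 2) by ring, norm_mul]; simp
  have hw3 : ‖w‖ ≤ 1 / 3 := by
    rw [hwn]; apply one_div_le_one_div_of_le <;> linarith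
  rw [log_add_one_sub_log hz0]
  have hlog := norm_log_sub_log_sub_le hw3
  set E := Complex.log (1 + w) - Complex.log (1 + -w) - (2 * w + 2 / 3 * w ^ 3) with hE
  -- The cubic expansion contributes w²/3 = 1/(12(z + 1/2)²), and z(z + 1) = (z + 1/2)² - 1/4 gives
  -- the factor 1/48.
  have hid : (z + 1 / 2) * (Complex.log (1 + w) - Complex.log (1 + -w)) - 1 -
      (1 / (12 * z) - 1 / (12 * (z + 1))) =
      (z + 1 / 2) * E - 1 / (48 * (z * (z + 1) * (z + 1 / 2) ^ 2)) := by
    have h1 : Complex.log (1 + w) - Complex.log (1 + -w) = E + (2 * w + 2 / 3 * w ^ 3) := by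
      rw [hE]; ring
    have hz2' : z + 1 / 2 = (2 * z + 1) / 2 := by ring
    rw [h1, hw, hz2']
    field_simp
    ring
  rw [hid]
  have hxpos : 0 < ‖z‖ := by simpa using hzne
  have hb1 : ‖(z + 1 / 2) * E‖ ≤ 3 / 160 / ‖z + 1 / 2‖ ^ 4 := by
    rw [norm_mul]
    have hp : 0 < ‖z + 1 / 2‖ := by linarith
    calc ‖z + 1 / 2‖ * ‖E‖ ≤ ‖z + 1 / 2‖ * (3 / 5 * ‖w‖ ^ 5) := by gcongr
      _ = _ := by rw [hwn]; field_simp; norm_num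
  have hb2 : 3 / 160 / ‖z + 1 / 2‖ ^ 4 ≤ 1 / 80 / ‖z‖ * (1 / z.re - 1 / (z.re + 1)) := by
    have h1 : ‖z‖ * (3 / 2) * (z.re * (z.re + 1)) ≤ ‖z + 1 / 2‖ ^ 4 := by
      calc ‖z‖ * (3 / 2) * (z.re * (z.re + 1))
          ≤ ‖z + 1 / 2‖ * (z.re + 1 / 2) * ((z.re + 1 / 2) * (z.re + 1 / 2)) := by
            have h5 : z.re * (z.re + 1) ≤ (z.re + 1 / 2) * (z.re + 1 / 2) := by nlinarith
            have h6 : 3 / 2 ≤ z.re + 1 / 2 := by linarith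
            gcongr
        _ ≤ ‖z + 1 / 2‖ * ‖z + 1 / 2‖ * (‖z + 1 / 2‖ * ‖z + 1 / 2‖) := by gcongr
        _ = _ := by ring
    calc 3 / 160 / ‖z + 1 / 2‖ ^ 4 ≤ 3 / 160 / (‖z‖ * (3 / 2) * (z.re * (z.re + 1))) := by gcongr
      _ = _ := by field_simp; norm_num
  have hb3 : ‖1 / (48 * (z * (z + 1) * (z + 1 / 2) ^ 2))‖ ≤
      1 / 96 / ‖z‖ * (1 / z.re - 1 / (z.re + 1)) := by
    rw [norm_div, norm_one, norm_mul, norm_mul, norm_mul, norm_pow]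
    have h1 : ‖z‖ * 2 * (z.re * (z.re + 1)) ≤ ‖z‖ * ‖z + 1‖ * ‖z + 1 / 2‖ ^ 2 := by
      calc ‖z‖ * 2 * (z.re * (z.re + 1)) ≤ ‖z‖ * ‖z + 1‖ * (z.re + 1 / 2) ^ 2 := by
            gcongr <;> nlinarith
        _ ≤ _ := by gcongr
    have h48 : ‖(48 : ℂ)‖ = 48 := by simp
    rw [h48]
    calc 1 / (48 * (‖z‖ * ‖z + 1‖ * ‖z + 1 / 2‖ ^ 2))
        ≤ 1 / (48 * (‖z‖ * 2 * (z.re * (z.re + 1)))) := by gcongr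
      _ = _ := by field_simp; norm_num
  have hpos : 0 ≤ 1 / ‖z‖ * (1 / z.re - 1 / (z.re + 1)) := by
    apply mul_nonneg (by positivity)
    rw [sub_nonneg]
    exact one_div_le_one_div_of_le hz0 (by linarith)
  refine (norm_sub_le _ _).trans ?_
  calc _ ≤ 1 / 80 / ‖z‖ * (1 / z.re - 1 / (z.re + 1)) +
        1 / 96 / ‖z‖ * (1 / z.re - 1 / (z.re + 1)) := by linarith
    _ = (1 / 80 + 1 / 96) * (1 / ‖z‖ * (1 / z.re - 1 / (z.re + 1))) := by ring
    _ ≤ 23 / 1000 * (1 / ‖z‖ * (1 / z.re - 1 / (z.re + 1))) := by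
        gcongr; norm_num
    _ = _ := by ring

lemma tendsto_one_div_add_nat (x : ℝ) : Tendsto (fun n : ℕ => 1 / (x + n)) atTop (𝓝 0) :=
  tendsto_const_nhds.div_atTop (tendsto_atTop_add_const_left _ x tendsto_natCast_atTop_atTop)

lemma tendsto_one_div_add_nat_complex (z : ℂ) :
    Tendsto (fun n : ℕ => 1 / (12 * (z + n))) atTop (𝓝 0) := by
  have h : Tendsto (fun n : ℕ => 12 * (z + (n : ℂ))) atTop (Bornology.cobounded ℂ) := by
    rw [← tendsto_norm_atTop_iff_cobounded]
    have h1 : Tendsto (fun n : ℕ => (n : ℝ) - ‖z‖) atTop atTop :=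
      tendsto_atTop_add_const_right _ _ tendsto_natCast_atTop_atTop
    refine tendsto_atTop_mono (fun n => ?_) h1
    have h2 := norm_sub_norm_le (n : ℂ) (-z)
    rw [norm_neg, Complex.norm_natCast, sub_neg_eq_add, add_comm (n : ℂ) z] at h2
    rw [norm_mul, show ‖(12 : ℂ)‖ = 12 by simp]
    linarith [norm_nonneg (z + (n : ℂ))]
  simp only [one_div]
  exact tendsto_inv₀_cobounded.comp h

/-- Stirling's formula for `log ‖Γ z‖` with an explicit error bound on `1 ≤ re z`. -/
theorem abs_stirlingRem_le {z : ℂ} (hz : 1 ≤ z.re) : |stirlingRem z| ≤ 13 / 100 / ‖z‖ := by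
  have hz0 : 0 < z.re := by linarith
  have hzpos : 0 < ‖z‖ := by simpa using ne_zero_of_re_pos hz0
  -- Since ‖z‖ ≤ ‖z + n‖, the norm in the step bound can be replaced by the fixed ‖z‖, so the right
  -- side telescopes. The total is (1/12 + 23/1000)/‖z‖, below the stated 13/100.
  have hstep : ∀ n : ℕ, |(stirlingRem (z + n) - (1 / (12 * (z + n))).re) -
      (stirlingRem (z + (n + 1 : ℕ)) - (1 / (12 * (z + (n + 1 : ℕ)))).re)| ≤
      23 / 1000 / ‖z‖ * (1 / (z.re + n)) - 23 / 1000 / ‖z‖ * (1 / (z.re + (n + 1 : ℕ))) := by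
    intro n
    have hn : 1 ≤ (z + n).re := by simp; linarith [n.cast_nonneg (α := ℝ)]
    have hn0 : 0 < (z + n).re := by linarith
    have h1 := stirlingRem_sub_add_one hn0
    have h2 := (Complex.abs_re_le_norm _).trans (norm_stirling_step_le hn)
    rw [Complex.sub_re, ← h1, Complex.sub_re] at h2
    have h3 : ‖z‖ ≤ ‖z + n‖ := by
      simpa using norm_le_norm_add_ofReal hz0.le (t := n) n.cast_nonneg
    have h4 : (z + n).re = z.re + n := by simp
    rw [h4] at h2 hn0
    push_cast
    rw [← add_assoc, ← add_assoc, ← mul_sub]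
    calc _ ≤ 23 / 1000 / ‖z + n‖ * (1 / (z.re + n) - 1 / (z.re + n + 1)) := by
          refine le_trans (le_of_eq ?_) h2
          congr 1; ring
      _ ≤ _ := by
        gcongr
        rw [sub_nonneg]
        exact one_div_le_one_div_of_le hn0 (by linarith)
  have hu : Tendsto (fun n : ℕ => stirlingRem (z + n) - (1 / (12 * (z + n))).re) atTop (𝓝 0) := by
    simpa using (tendsto_stirlingRem_add_nat hz0).sub
      ((Complex.continuous_re.tendsto _).comp (tendsto_one_div_add_nat_complex z))
  have hb : Tendsto (fun n : ℕ => 23 / 1000 / ‖z‖ * (1 / (z.re + n))) atTop (𝓝 0) := by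
    simpa using (tendsto_one_div_add_nat z.re).const_mul (23 / 1000 / ‖z‖)
  have hle := le_of_sub_succ_le hu hb fun n => (abs_le.mp (hstep n)).2
  have hge := le_of_sub_succ_le (by simpa using hu.neg) hb
    (u := fun n : ℕ => -(stirlingRem (z + n) - (1 / (12 * (z + n))).re))
    fun n => by linarith [(abs_le.mp (hstep n)).1]
  simp only [Nat.cast_zero, add_zero] at hle hge
  have h12 : |(1 / (12 * z)).re| ≤ 1 / 12 * (1 / ‖z‖) := by
    refine (Complex.abs_re_le_norm _).trans (le_of_eq ?_)
    rw [norm_div, norm_one, norm_mul, show ‖(12 : ℂ)‖ = 12 by simp]; field_simp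
  have hone : 23 / 1000 / ‖z‖ * (1 / z.re) ≤ 23 / 1000 * (1 / ‖z‖) := by
    have : 1 / z.re ≤ 1 := by rw [div_le_one hz0]; exact hz
    calc _ ≤ 23 / 1000 / ‖z‖ * 1 := by gcongr
      _ = _ := by ring
  have hpos : 0 < 1 / ‖z‖ := by positivity
  have hgoal : 13 / 100 / ‖z‖ = 13 / 100 * (1 / ‖z‖) := by ring
  have := abs_le.mp h12
  rw [hgoal, abs_le]
  constructor <;> linarith [this.1, this.2]

/-! ### Two-sided bounds on the remainder on the real axis -/

lemma stirlingRem_ofReal_sub {x : ℝ} (hx : 0 < x) :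
    stirlingRem (x : ℂ) - stirlingRem ((x + 1 : ℝ) : ℂ) =
      (x + 1 / 2) * Real.log (1 + x⁻¹) - 1 := by
  have h := stirlingRem_sub_add_one (z := (x : ℂ)) (by simpa)
  have h1 : 1 + x⁻¹ = (x + 1) / x := by field_simp
  rw [h1, Real.log_div (by positivity) hx.ne']
  push_cast
  rw [h, ← Complex.ofReal_one, ← Complex.ofReal_add, ← Complex.ofReal_log hx.le,
    ← Complex.ofReal_log (by positivity), ← Complex.ofReal_re
      ((x + 1 / 2) * (Real.log (x + 1) - Real.log x) - 1)]
  push_cast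
  rfl

/-- The odd series for log(1 + 1/x) in powers of 1/(2x + 1); its leading term cancels the 1. All
remaining terms are positive, so truncation gives lower bounds and a geometric majorant gives upper
bounds. -/
lemma hasSum_stirling_step {x : ℝ} (hx : 0 < x) :
    HasSum (fun k : ℕ => 1 / (2 * ((k : ℝ) + 1) + 1) * (1 / (2 * x + 1)) ^ (2 * (k + 1)))
      ((x + 1 / 2) * Real.log (1 + x⁻¹) - 1) := by
  have h := (Real.hasSum_log_one_add_inv hx).mul_left (x + 1 / 2)
  rw [← hasSum_nat_add_iff' 1] at h
  simp only [Finset.range_one, Finset.sum_singleton] at h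
  convert! h using 1
  · ext k
    push_cast
    have : (1 / (2 * x + 1)) ^ (2 * (k + 1) + 1) =
      (1 / (2 * x + 1)) ^ (2 * (k + 1)) * (1 / (2 * x + 1)) := pow_succ _ _
    rw [this]
    field_simp
  · norm_num
    field_simp

lemma stirling_step_ge {x : ℝ} (hx : 0 < x) :
    1 / 3 * (1 / (2 * x + 1)) ^ 2 + 1 / 5 * (1 / (2 * x + 1)) ^ 4 ≤
      (x + 1 / 2) * Real.log (1 + x⁻¹) - 1 := by
  have h := sum_le_hasSum (Finset.range 2) (fun k _ => by positivity) (hasSum_stirling_step hx)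
  rw [Finset.sum_range_succ, Finset.sum_range_one] at h
  norm_num at h ⊢
  exact h

lemma stirling_step_le {x : ℝ} (hx : 0 < x) :
    (x + 1 / 2) * Real.log (1 + x⁻¹) - 1 ≤
      1 / 3 * (1 / (2 * x + 1)) ^ 2 + 1 / (20 * (x * (x + 1))) * (1 / (2 * x + 1)) ^ 2 := by
  have h := hasSum_stirling_step hx
  rw [← hasSum_nat_add_iff' 1] at h
  have hu : (1 / (2 * x + 1)) ^ 2 < 1 := by
    rw [div_pow, one_pow, div_lt_one (by positivity)]; nlinarith
  have hg := ((hasSum_geometric_of_lt_one (by positivity) hu).mul_left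
    (1 / 5 * (1 / (2 * x + 1)) ^ 4))
  have hle := hasSum_le (fun k => ?_) h hg
  · rw [Finset.sum_range_one] at hle
    have h1 : 1 / 5 * (1 / (2 * x + 1)) ^ 4 * (1 - (1 / (2 * x + 1)) ^ 2)⁻¹ =
        1 / (20 * (x * (x + 1))) * (1 / (2 * x + 1)) ^ 2 := by
      have h2 : 1 - (1 / (2 * x + 1)) ^ 2 = 4 * x * (x + 1) / (2 * x + 1) ^ 2 := by
        field_simp; ring
      rw [h2]
      field_simp
      norm_num
    rw [h1] at hle
    norm_num at hle ⊢
    linarith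
  · have h3 : (1 / (2 * x + 1)) ^ (2 * (k + 1 + 1)) =
        (1 / (2 * x + 1)) ^ 4 * ((1 / (2 * x + 1)) ^ 2) ^ k := by ring
    push_cast
    rw [h3, ← mul_assoc]
    gcongr
    have := k.cast_nonneg (α := ℝ)
    linarith

/-- The rational function bounding the remainder from above on `[1, ∞)`. -/
def remUpper (x : ℝ) : ℝ := x / (12 * x ^ 2 + 3 / 10)

/-- At infinity `remUpper` is 1/(12x) - (0.3/144)x⁻³ + ⋯, slightly above the Stirling expansion
1/(12x) - x⁻³/360 + ⋯; taking 3/10 instead of 2/5 leaves the slack needed on all of [1, ∞). -/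
lemma stirling_step_le_remUpper {x : ℝ} (hx : 1 ≤ x) :
    (x + 1 / 2) * Real.log (1 + x⁻¹) - 1 ≤ remUpper x - remUpper (x + 1) := by
  have hx0 : 0 < x := by linarith
  refine (stirling_step_le hx0).trans ?_
  -- Both sides depend on x only through y; after clearing denominators the cubic terms in y cancel
  -- and y ≥ 2 suffices.
  set y := x * (x + 1) with hy
  have hy2 : 2 ≤ y := by rw [hy]; nlinarith
  have h1 : 1 / 3 * (1 / (2 * x + 1)) ^ 2 + 1 / (20 * y) * (1 / (2 * x + 1)) ^ 2 =
      (20 * y + 3) / (60 * y * (4 * y + 1)) := by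
    have : (2 * x + 1) ^ 2 = 4 * y + 1 := by rw [hy]; ring
    rw [div_pow, one_pow, this]
    field_simp
    ring
  have h2 : remUpper x - remUpper (x + 1) =
      (12 * y - 3 / 10) / (144 * y ^ 2 + 36 / 5 * y + 369 / 100) := by
    have : 144 * y ^ 2 + 36 / 5 * y + 369 / 100 =
        (12 * x ^ 2 + 3 / 10) * (12 * (x + 1) ^ 2 + 3 / 10) := by rw [hy]; ring
    rw [this, remUpper, remUpper, div_sub_div _ _ (by positivity) (by positivity), hy]
    congr 1
    ring
  rw [h1, h2, div_le_div_iff₀ (by positivity) (by positivity)]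
  nlinarith

lemma tendsto_remUpper : Tendsto remUpper atTop (𝓝 0) := by
  refine squeeze_zero' (g := fun x : ℝ => x⁻¹) ?_ ?_ tendsto_inv_atTop_zero
  · filter_upwards [eventually_gt_atTop 0] with x hx
    unfold remUpper
    positivity
  · filter_upwards [eventually_gt_atTop 0] with x hx
    rw [remUpper, inv_eq_one_div, div_le_div_iff₀ (by positivity) hx]
    nlinarith

lemma tendsto_stirlingRem_ofReal_add_nat {x : ℝ} (hx : 0 < x) :
    Tendsto (fun n : ℕ => stirlingRem ((x + n : ℝ) : ℂ)) atTop (𝓝 0) := by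
  simpa using tendsto_stirlingRem_add_nat (z := (x : ℂ)) (by simpa)

lemma stirlingRem_le_remUpper {x : ℝ} (hx : 1 ≤ x) : stirlingRem (x : ℂ) ≤ remUpper x := by
  have h := le_of_sub_succ_le (tendsto_stirlingRem_ofReal_add_nat (x := x) (by linarith))
    (tendsto_remUpper.comp (tendsto_atTop_add_const_left _ x tendsto_natCast_atTop_atTop))
    fun n => by
      have hn : 1 ≤ x + n := by linarith [n.cast_nonneg (α := ℝ)]
      have h1 := stirlingRem_ofReal_sub (x := x + n) (by linarith)
      have h2 := stirling_step_le_remUpper hn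
      rw [← h1] at h2
      simpa [add_assoc] using h2
  simpa using h

/-- Through log(1 + t) ≥ 2t/(t + 2) this reduces to 0.124x² - 0.177x + 0.0531 ≥ 0. At x = 1 the left
side is only 0.0001, so 0.177 is nearly the smallest constant this argument permits. -/
lemma remUpper_le {x : ℝ} (hx : 1 ≤ x) : remUpper x ≤ Real.log (1 + 0.177 / x) / 2 := by
  have hx0 : 0 < x := by linarith
  have h1 := Real.le_log_one_add_of_nonneg (x := 0.177 / x) (by positivity)
  have h2 : 2 * remUpper x ≤ 2 * (0.177 / x) / (0.177 / x + 2) := by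
    have : 2 * (0.177 / x) / (0.177 / x + 2) = 2 * 0.177 / (0.177 + 2 * x) := by field_simp
    rw [this, remUpper, ← mul_div_assoc, div_le_div_iff₀ (by positivity) (by positivity)]
    norm_num
    nlinarith
  linarith

/-- The logarithmic function bounding the remainder from below on `[1, ∞)`. -/
def remLower (x : ℝ) : ℝ := Real.log (1 + 1 / (6 * x)) / 2

lemma remLower_sub_le {x : ℝ} (hx : 1 ≤ x) :
    remLower x - remLower (x + 1) ≤ (x + 1 / 2) * Real.log (1 + x⁻¹) - 1 := by
  have hx0 : 0 < x := by linarith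
  refine le_trans ?_ (stirling_step_ge hx0)
  have h1 : remLower x - remLower (x + 1) ≤ 1 / (12 * x ^ 2 + 14 * x) := by
    -- The quotient is exactly 1 plus a small term, so log t ≤ t - 1 loses little.
    have h2 : (1 + 1 / (6 * x)) / (1 + 1 / (6 * (x + 1))) = 1 + 1 / (6 * x ^ 2 + 7 * x) := by
      have h3 : 6 * x ^ 2 + 7 * x = x * (6 * x + 7) := by ring
      rw [h3]
      field_simp
      ring
    rw [remLower, remLower, ← sub_div, ← Real.log_div (by positivity) (by positivity), h2]
    have h4 := Real.log_le_sub_one_of_pos (x := 1 + 1 / (6 * x ^ 2 + 7 * x)) (by positivity)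
    have h5 : 1 / (12 * x ^ 2 + 14 * x) = 1 / (6 * x ^ 2 + 7 * x) / 2 := by
      rw [div_div]; congr 1; ring
    rw [h5]
    linarith
  refine h1.trans ?_
  have h6 : 1 / 3 * (1 / (2 * x + 1)) ^ 2 + 1 / 5 * (1 / (2 * x + 1)) ^ 4 =
      (5 * (2 * x + 1) ^ 2 + 3) / (15 * (2 * x + 1) ^ 4) := by field_simp; norm_num
  rw [h6, div_le_div_iff₀ (by positivity) (by positivity)]
  nlinarith [mul_pos hx0 hx0, mul_pos (mul_pos hx0 hx0) hx0]

lemma tendsto_remLower : Tendsto remLower atTop (𝓝 0) := by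
  have h1 : Tendsto (fun x : ℝ => 1 / (6 * x)) atTop (𝓝 0) :=
    tendsto_const_nhds.div_atTop (tendsto_id.const_mul_atTop (by norm_num))
  have h2 := ((h1.const_add 1).log (by norm_num)).div_const 2
  rw [add_zero, Real.log_one, zero_div] at h2
  exact h2

lemma remLower_le_stirlingRem {x : ℝ} (hx : 1 ≤ x) : remLower x ≤ stirlingRem (x : ℂ) := by
  have h := le_of_sub_succ_le
    (tendsto_remLower.comp (tendsto_atTop_add_const_left _ x tendsto_natCast_atTop_atTop))
    (tendsto_stirlingRem_ofReal_add_nat (x := x) (by linarith))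
    fun n => by
      have hn : 1 ≤ x + n := by linarith [n.cast_nonneg (α := ℝ)]
      have h1 := stirlingRem_ofReal_sub (x := x + n) (by linarith)
      have h2 := remLower_sub_le hn
      rw [← h1] at h2
      simpa [add_assoc] using h2
  simpa using h

/-! ### Bounds on the normalization constant -/

lemma log_Gamma_eq {x : ℝ} (hx : 0 < x) :
    Real.log (Real.Gamma x) = (x - 1 / 2) * Real.log x - x + Real.log (2 * Real.pi) / 2 +
      stirlingRem (x : ℂ) := by
  rw [stirlingRem, stirlingMain, Complex.Gamma_ofReal, Complex.norm_real, Real.norm_eq_abs,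
    abs_of_pos (Real.Gamma_pos_of_pos hx), ← Complex.ofReal_log hx.le,
    ← Complex.ofReal_re ((x - 1 / 2) * Real.log x - x)]
  push_cast
  ring

/-- The argument of the Gamma function in the normalization constant. -/
def gammaArg (a s : ℝ) : ℂ := (a : ℂ) - Complex.I * (s : ℂ) / 2

lemma gammaArg_eq (a s : ℝ) : gammaArg a s = ⟨a, -(s / 2)⟩ := by
  apply Complex.ext <;> simp [gammaArg]

lemma norm_gammaArg (a s : ℝ) : ‖gammaArg a s‖ = Real.sqrt (a ^ 2 + (s / 2) ^ 2) := by
  rw [gammaArg_eq, Complex.norm_def, Complex.normSq_mk]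
  congr 1; ring

lemma log_norm_gammaArg {a : ℝ} (ha : 0 < a) (s : ℝ) :
    2 * Real.log ‖gammaArg a s‖ = 2 * Real.log a + Real.log (1 + (s / (2 * a)) ^ 2) := by
  rw [norm_gammaArg, Real.log_sqrt (by positivity)]
  have : a ^ 2 + (s / 2) ^ 2 = a ^ 2 * (1 + (s / (2 * a)) ^ 2) := by field_simp
  rw [this, Real.log_mul (by positivity) (by positivity), Real.log_pow]
  push_cast
  ring

lemma arg_gammaArg {a : ℝ} (ha : 0 < a) (s : ℝ) :
    (gammaArg a s).arg = -Real.arctan (s / (2 * a)) := by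
  have h := Complex.abs_arg_lt_pi_div_two_iff.mpr
    (Or.inl (show 0 < (gammaArg a s).re by rw [gammaArg_eq]; exact ha))
  have h2 : Real.tan (gammaArg a s).arg = -(s / (2 * a)) := by
    rw [Complex.tan_arg, gammaArg_eq]
    field_simp
  rw [← Real.arctan_neg, ← h2, Real.arctan_tan (abs_lt.mp h).1 (abs_lt.mp h).2]

lemma log_norm_Gamma_gammaArg {a : ℝ} (ha : 0 < a) (s : ℝ) :
    2 * Real.log ‖Complex.Gamma (gammaArg a s)‖ =
      (a - 1 / 2) * (2 * Real.log a + Real.log (1 + (s / (2 * a)) ^ 2)) -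
        s * Real.arctan (s / (2 * a)) - 2 * a + Real.log (2 * Real.pi) +
        2 * stirlingRem (gammaArg a s) := by
  have hre : (gammaArg a s).re = a := by rw [gammaArg_eq]
  have him : (gammaArg a s).im = -(s / 2) := by rw [gammaArg_eq]
  rw [stirlingRem, stirlingMain, ← log_norm_gammaArg ha]
  simp only [Complex.sub_re, Complex.mul_re, Complex.sub_im, Complex.log_re, Complex.log_im,
    hre, him, arg_gammaArg ha]
  norm_num
  ring

lemma gammaConst_pos {a : ℝ} (ha : 1 ≤ a) (s : ℝ) : 0 < gammaConst a s := by
  have h1 : Complex.Gamma (gammaArg a s) ≠ 0 :=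
    Complex.Gamma_ne_zero_of_re_pos (by rw [gammaArg_eq]; show 0 < a; linarith)
  have h2 := Real.Gamma_pos_of_pos (show 0 < a by linarith)
  have h3 := Real.Gamma_pos_of_pos (show 0 < a - 1 / 2 by linarith)
  have h4 := Real.Gamma_pos_of_pos (show (0 : ℝ) < 1 / 2 by norm_num)
  have h5 : 0 < ‖Complex.Gamma (gammaArg a s)‖ := norm_pos_iff.mpr h1
  rw [gammaConst, ← gammaArg]
  positivity

lemma gammaStar_pos {a : ℝ} (ha : 1 ≤ a) (s : ℝ) : 0 < gammaStar a s := by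
  have h1 : 0 < a - 1 / 2 := by linarith
  have h2 : 0 < 1 + (s / (2 * a)) ^ 2 := by positivity
  unfold gammaStar
  have := Real.pi_pos
  positivity

/-- An exact identity. Γ(a - 1/2) is first shifted to Γ(a + 1/2), which keeps every argument in the
region re ≥ 1 where the remainder bounds hold; this is the origin of the factor a - 1/2 in
`gammaStar`. -/
lemma log_gammaConst {a : ℝ} (ha : 1 ≤ a) (s : ℝ) :
    Real.log (gammaConst a s) = Real.log (gammaStar a s) +
      (2 * stirlingRem (gammaArg a s) - stirlingRem (a : ℂ) -
        stirlingRem ((a + 1 / 2 : ℝ) : ℂ)) := by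
  have ha0 : 0 < a := by linarith
  have ha1 : 0 < a - 1 / 2 := by linarith
  have h1 : Complex.Gamma (gammaArg a s) ≠ 0 :=
    Complex.Gamma_ne_zero_of_re_pos (by rw [gammaArg_eq]; show 0 < a; linarith)
  have h2 := Real.Gamma_pos_of_pos ha0
  have h3 := Real.Gamma_pos_of_pos ha1
  have h4 : Real.Gamma (a + 1 / 2) = (a - 1 / 2) * Real.Gamma (a - 1 / 2) := by
    rw [← Real.Gamma_add_one ha1.ne']; congr 1; ring
  have h5 := congrArg Real.log h4
  rw [Real.log_mul ha1.ne' h3.ne', log_Gamma_eq (x := a + 1 / 2) (by positivity)] at h5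
  have h6 := log_norm_Gamma_gammaArg ha0 s
  have hpi := Real.pi_pos
  have h7 : Real.log (gammaConst a s) = 2 * Real.log ‖Complex.Gamma (gammaArg a s)‖ -
      (Real.log (Real.Gamma a) + Real.log (Real.Gamma (a - 1 / 2)) + Real.log Real.pi / 2) := by
    rw [gammaConst, ← gammaArg, Real.Gamma_one_half_eq, Real.log_div (by simpa using h1)
      (by positivity), Real.log_pow, Real.log_mul (by positivity) (by positivity),
      Real.log_mul (by positivity) (by positivity), Real.log_sqrt hpi.le]
    push_cast
    ring
  have h8 : Real.log (gammaStar a s) = Real.log (a - 1 / 2) +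
      (a - 1 / 2) * Real.log (1 + (s / (2 * a)) ^ 2) - s * Real.arctan (s / (2 * a)) -
      ((Real.log Real.pi - 1) / 2 + a * (Real.log (a + 1 / 2) - Real.log a) +
        Real.log a / 2) := by
    have h9 : 1 + 1 / (2 * a) = (a + 1 / 2) / a := by field_simp
    have h10 : 0 < 1 + (s / (2 * a)) ^ 2 := by positivity
    rw [gammaStar, h9, Real.log_div (by positivity) (by positivity),
      Real.log_mul (by positivity) (by positivity), Real.log_mul (by positivity) (by positivity),
      Real.log_mul (by positivity) (by positivity), Real.log_mul (by positivity) (by positivity),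
      Real.log_exp, Real.log_sqrt ha0.le, Real.log_sqrt (by positivity),
      Real.log_div hpi.ne' (Real.exp_pos 1).ne', Real.log_exp, Real.log_rpow h10,
      Real.log_rpow (by positivity), Real.log_div (by positivity) (by positivity)]
    ring
  rw [h7, h6, log_Gamma_eq ha0, h8]
  rw [Real.log_mul two_ne_zero hpi.ne'] at *
  linarith

lemma le_norm_gammaArg (a s : ℝ) : a ≤ ‖gammaArg a s‖ := by
  rw [norm_gammaArg]
  exact Real.le_sqrt_of_sq_le (by nlinarith [sq_nonneg (s / 2)])

lemma err_eq (a s : ℝ) : err a s = 3 / (2 * Real.pi ^ 2) / ‖gammaArg a s‖ := by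
  rw [err, norm_gammaArg, div_div]

lemma err_pos {a : ℝ} (ha : 1 ≤ a) (s : ℝ) : 0 < err a s := by
  have := le_norm_gammaArg a s
  have hpi := Real.pi_pos
  rw [err_eq]
  have : 0 < ‖gammaArg a s‖ := by linarith
  positivity

lemma err_le {a : ℝ} (ha : 1 ≤ a) (s : ℝ) : err a s ≤ 3 / (2 * Real.pi ^ 2) / a := by
  have hpi := Real.pi_pos
  rw [err_eq]
  have := le_norm_gammaArg a s
  gcongr

lemma three_div_two_pi_sq_le : 3 / (2 * Real.pi ^ 2) ≤ 153 / 1000 := by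
  have := Real.pi_gt_d4
  rw [div_le_div_iff₀ (by positivity) (by norm_num)]
  nlinarith

lemma le_three_div_two_pi_sq : 151 / 1000 ≤ 3 / (2 * Real.pi ^ 2) := by
  have h1 := Real.pi_lt_d4
  have h2 := Real.pi_pos
  rw [div_le_div_iff₀ (by norm_num) (by positivity)]
  nlinarith

lemma err_le_const {a : ℝ} (ha : 1 ≤ a) (s : ℝ) : err a s ≤ 3 / (2 * Real.pi ^ 2) := by
  refine (err_le ha s).trans (div_le_self (by positivity) ha)

lemma err_lt_one {a : ℝ} (ha : 1 ≤ a) (s : ℝ) : err a s < 1 := by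
  linarith [err_le_const ha s, three_div_two_pi_sq_le]

lemma stirlingRem_gammaArg_le {a : ℝ} (ha : 1 ≤ a) (s : ℝ) :
    stirlingRem (gammaArg a s) ≤ Real.log (1 + err a s) ∧
      Real.log (1 - err a s) ≤ stirlingRem (gammaArg a s) := by
  have h1 := abs_le.mp (abs_stirlingRem_le (z := gammaArg a s) (by rw [gammaArg_eq]; exact ha))
  have hn : 0 < ‖gammaArg a s‖ := by linarith [le_norm_gammaArg a s]
  have he := err_pos ha s
  have he1 := err_le_const ha s
  have hc := three_div_two_pi_sq_le
  -- As ε ≤ 0.153, the lower bound ε/(1 + ε) of log(1 + ε) is at least ε/1.153. The constant 13/100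
  -- is small enough to survive this loss.
  have h2 : 13 / 100 / ‖gammaArg a s‖ ≤ 1000 / 1153 * err a s := by
    rw [err_eq, ← mul_div_assoc]
    gcongr
    linarith [le_three_div_two_pi_sq]
  constructor
  · have h3 := Real.one_sub_inv_le_log_of_pos (x := 1 + err a s) (by linarith)
    have h4 : 1000 / 1153 * err a s ≤ 1 - (1 + err a s)⁻¹ := by
      have : 1 - (1 + err a s)⁻¹ = err a s / (1 + err a s) := by field_simp; ring
      rw [this, le_div_iff₀ (by linarith)]
      nlinarith
    linarith [h1.2]
  · have h3 := Real.log_le_sub_one_of_pos (x := 1 - err a s) (by linarith)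
    linarith [h1.1]

lemma log_upper_factor {ε p q : ℝ} (hε : 0 < ε) (hp : 0 < p) (hq : 0 < q) :
    Real.log (ε ^ 2 / (Real.sqrt p * Real.sqrt q)) =
      2 * Real.log ε - Real.log p / 2 - Real.log q / 2 := by
  rw [Real.log_div (by positivity) (by positivity), Real.log_mul (by positivity) (by positivity),
    Real.log_sqrt hp.le, Real.log_sqrt hq.le, Real.log_pow]
  push_cast
  ring

lemma gammaLower_pos {a : ℝ} (ha : 1 ≤ a) (s : ℝ) : 0 < gammaLower a s := by
  have h1 := gammaStar_pos ha s
  have h2 : 0 < 1 - err a s := by linarith [err_lt_one ha s]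
  have h3 : 0 < a := by linarith
  unfold gammaLower
  positivity

lemma gammaUpper_pos {a : ℝ} (ha : 1 ≤ a) (s : ℝ) : 0 < gammaUpper a s := by
  have h1 := gammaStar_pos ha s
  have h2 := err_pos ha s
  have h3 : 0 < a := by linarith
  unfold gammaUpper
  positivity

/-- The real remainders enter log γ with a minus sign, so their upper bounds serve here and their
lower bounds serve for `le_gammaUpper`. -/
theorem gammaLower_le {a : ℝ} (ha : 1 ≤ a) (s : ℝ) : gammaLower a s ≤ gammaConst a s := by
  have ha0 : 0 < a := by linarith
  have h0 : 0 < 1 - err a s := by linarith [err_lt_one ha s]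
  rw [← Real.log_le_log_iff (gammaLower_pos ha s) (gammaConst_pos ha s), log_gammaConst ha,
    gammaLower, Real.log_mul (gammaStar_pos ha s).ne' (by positivity),
    log_upper_factor h0 (by positivity) (by positivity)]
  have h1 := (stirlingRem_le_remUpper ha).trans (remUpper_le ha)
  have h2 := (stirlingRem_le_remUpper (x := a + 1 / 2) (by linarith)).trans
    (remUpper_le (by linarith))
  linarith [(stirlingRem_gammaArg_le ha s).2]

theorem le_gammaUpper {a : ℝ} (ha : 1 ≤ a) (s : ℝ) : gammaConst a s ≤ gammaUpper a s := by
  have ha0 : 0 < a := by linarith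
  have h0 : 0 < 1 + err a s := by linarith [err_pos ha s]
  rw [← Real.log_le_log_iff (gammaConst_pos ha s) (gammaUpper_pos ha s), log_gammaConst ha,
    gammaUpper, Real.log_mul (gammaStar_pos ha s).ne' (by positivity),
    log_upper_factor h0 (by positivity) (by positivity)]
  have h1 := remLower_le_stirlingRem ha
  have h2 := remLower_le_stirlingRem (x := a + 1 / 2) (by linarith)
  rw [remLower] at h1 h2
  linarith [(stirlingRem_gammaArg_le ha s).1]

/-! ### The normalization `∫ h = 1` -/

/-- The integral `∫ e^{sy} (cos y)^q dy` over `[-π/2, π/2]`. -/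
def cosInt (q s : ℝ) : ℝ :=
  ∫ y in (-(Real.pi / 2))..(Real.pi / 2), Real.exp (s * y) * Real.cos y ^ q

lemma continuous_exp_mul_cos_rpow {q : ℝ} (hq : 0 ≤ q) (s : ℝ) :
    Continuous fun y : ℝ => Real.exp (s * y) * Real.cos y ^ q := by
  have := Real.continuous_cos.rpow_const (p := q) fun _ => Or.inr hq
  fun_prop

lemma cosInt_pos {q : ℝ} (hq : 0 ≤ q) (s : ℝ) : 0 < cosInt q s := by
  refine intervalIntegral.intervalIntegral_pos_of_pos_on
    ((continuous_exp_mul_cos_rpow hq s).intervalIntegrable _ _) (fun y hy => ?_)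
    (by linarith [Real.pi_pos])
  have := Real.cos_pos_of_mem_Ioo hy
  positivity

/-- Two integrations by parts combined in one antiderivative, whose factor cos^(q-1) vanishes at
both endpoints. -/
lemma cosInt_recurrence {q : ℝ} (hq : 2 ≤ q) (s : ℝ) :
    (s ^ 2 + q ^ 2) * cosInt q s = q * (q - 1) * cosInt (q - 2) s := by
  have hpi := Real.pi_pos
  have hc0 := continuous_exp_mul_cos_rpow (show 0 ≤ q by linarith) s
  have hc2 := continuous_exp_mul_cos_rpow (show 0 ≤ q - 2 by linarith) s
  have hc1 : Continuous fun y => Real.cos y ^ (q - 1) :=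
    Real.continuous_cos.rpow_const fun _ => Or.inr (by linarith)
  have hder : ∀ y ∈ Set.Ioo (-(Real.pi / 2)) (Real.pi / 2),
      HasDerivAt (fun y => Real.exp (s * y) * Real.cos y ^ (q - 1) *
        (s * Real.cos y + q * Real.sin y))
        ((s ^ 2 + q ^ 2) * (Real.exp (s * y) * Real.cos y ^ q) -
          q * (q - 1) * (Real.exp (s * y) * Real.cos y ^ (q - 2))) y := by
    intro y hy
    have hcos := Real.cos_pos_of_mem_Ioo hy
    have h1 : HasDerivAt (fun y => Real.exp (s * y)) (Real.exp (s * y) * s) y := by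
      simpa using ((hasDerivAt_id y).const_mul s).exp
    have h2 := (Real.hasDerivAt_cos y).rpow_const (p := q - 1) (Or.inl hcos.ne')
    have h3 := ((Real.hasDerivAt_cos y).const_mul s).add ((Real.hasDerivAt_sin y).const_mul q)
    refine ((h1.mul h2).mul h3).congr_deriv ?_
    have e1 : Real.cos y ^ (q - 1) = Real.cos y ^ (q - 2) * Real.cos y := by
      rw [← Real.rpow_add_one hcos.ne']; congr 1; ring
    have e2 : Real.cos y ^ q = Real.cos y ^ (q - 2) * Real.cos y * Real.cos y := by
      rw [← e1, ← Real.rpow_add_one hcos.ne']; congr 1; ring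
    have e3 : q - 1 - 1 = q - 2 := by ring
    rw [e2, e3]
    simp only [Pi.mul_apply, Pi.add_apply]
    rw [e1]
    linear_combination (-Real.exp (s * y) * Real.cos y ^ (q - 2) * q * (q - 1)) *
      Real.sin_sq_add_cos_sq y
  have h := intervalIntegral.integral_eq_sub_of_hasDerivAt_of_le (by linarith)
    (by fun_prop) hder
    (Continuous.intervalIntegrable (by fun_prop) _ _)
  rw [intervalIntegral.integral_sub ((hc0.const_mul _).intervalIntegrable _ _)
    ((hc2.const_mul _).intervalIntegrable _ _), intervalIntegral.integral_const_mul,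
    intervalIntegral.integral_const_mul, Real.cos_neg, Real.cos_pi_div_two,
    Real.zero_rpow (by linarith)] at h
  simp only [mul_zero, zero_mul, sub_zero] at h
  rw [cosInt, cosInt]
  linarith

lemma cosInt_neg (q s : ℝ) : cosInt q (-s) = cosInt q s := by
  have h := intervalIntegral.integral_comp_neg (a := -(Real.pi / 2)) (b := Real.pi / 2)
    fun y => Real.exp (s * y) * Real.cos y ^ q
  simp only [neg_neg, Real.cos_neg, mul_neg] at h
  rw [cosInt, cosInt, ← h]
  simp only [neg_mul]

lemma cosInt_eq_cosh {q : ℝ} (hq : 0 ≤ q) (s : ℝ) :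
    cosInt q s = ∫ y in (-(Real.pi / 2))..(Real.pi / 2), Real.cosh (s * y) * Real.cos y ^ q := by
  have h : cosInt q s = (cosInt q s + cosInt q (-s)) / 2 := by rw [cosInt_neg]; ring
  rw [h, cosInt, cosInt, ← intervalIntegral.integral_add
    ((continuous_exp_mul_cos_rpow hq s).intervalIntegrable _ _)
    ((continuous_exp_mul_cos_rpow hq (-s)).intervalIntegrable _ _),
    ← intervalIntegral.integral_div]
  congr 1
  ext y
  rw [Real.cosh_eq, neg_mul]
  ring

/-- The bound is in terms of sin² y because sin² y cos^q y = cos^q y - cos^(q+2) y, so the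
recurrence at s = 0 turns it into a relative error of order 1/(q + 2). It follows from cosh t ≤
e^{t²/2} and Jordan's inequality. -/
lemma exists_cosh_le (s : ℝ) : ∃ C : ℝ, 0 ≤ C ∧ ∀ y ∈ Set.Icc (-(Real.pi / 2)) (Real.pi / 2),
    Real.cosh (s * y) ≤ 1 + C * Real.sin y ^ 2 := by
  have hpi := Real.pi_pos
  set K := (s * (Real.pi / 2)) ^ 2 / 2 with hK
  refine ⟨K * Real.exp K, by positivity, fun y hy => ?_⟩
  have hy' : |y| ≤ Real.pi / 2 := abs_le.mpr hy
  have h1 : y ^ 2 ≤ (Real.pi / 2) ^ 2 * Real.sin y ^ 2 := by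
    have h := Real.mul_abs_le_abs_sin hy'
    have h2 : |y| ≤ Real.pi / 2 * |Real.sin y| := by
      calc |y| = Real.pi / 2 * (2 / Real.pi * |y|) := by field_simp
        _ ≤ _ := by gcongr
    rw [← sq_abs y, ← sq_abs (Real.sin y), ← mul_pow]
    gcongr
  set u := (s * y) ^ 2 / 2 with hu
  have hu0 : 0 ≤ u := by positivity
  have huK : u ≤ K * Real.sin y ^ 2 := by
    rw [hu, hK]
    nlinarith [mul_le_mul_of_nonneg_left h1 (sq_nonneg s)]
  have hK0 : 0 ≤ K := by positivity
  have huK' : u ≤ K := huK.trans (mul_le_of_le_one_right hK0 (Real.sin_sq_le_one y))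
  have h3 : Real.exp u ≤ 1 + u * Real.exp u := by
    have h4 := Real.add_one_le_exp (-u)
    have h5 : Real.exp (-u) * Real.exp u = 1 := by rw [← Real.exp_add]; simp
    nlinarith [Real.exp_pos u]
  calc Real.cosh (s * y) ≤ Real.exp u := Real.cosh_le_exp_half_sq _
    _ ≤ 1 + u * Real.exp u := h3
    _ ≤ 1 + (K * Real.sin y ^ 2) * Real.exp K := by gcongr
    _ = _ := by ring

lemma cosInt_zero_le {q : ℝ} (hq : 0 ≤ q) (s : ℝ) : cosInt q 0 ≤ cosInt q s := by
  have hpi := Real.pi_pos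
  rw [cosInt_eq_cosh hq, cosInt_eq_cosh hq]
  have hc := Real.continuous_cos.rpow_const (p := q) fun _ => Or.inr hq
  refine intervalIntegral.integral_mono_on (by linarith)
    (Continuous.intervalIntegrable (by fun_prop) _ _)
    (Continuous.intervalIntegrable (by fun_prop) _ _) fun y hy => ?_
  have := Real.cos_nonneg_of_mem_Icc hy
  rw [zero_mul, Real.cosh_zero]
  gcongr
  exact Real.one_le_cosh _

lemma exists_cosInt_le (s : ℝ) : ∃ C : ℝ, ∀ q : ℝ, 0 ≤ q →
    cosInt q s ≤ cosInt q 0 * (1 + C / (q + 2)) := by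
  have hpi := Real.pi_pos
  obtain ⟨C, hC, h⟩ := exists_cosh_le s
  refine ⟨C, fun q hq => ?_⟩
  have hc := Real.continuous_cos.rpow_const (p := q) fun _ => Or.inr hq
  have hc2 := Real.continuous_cos.rpow_const (p := q + 2) fun _ => Or.inr (by linarith)
  have hrec := cosInt_recurrence (q := q + 2) (by linarith) 0
  have hrec2 : cosInt (q + 2) 0 = (q + 1) / (q + 2) * cosInt q 0 := by
    have h1 : q + 2 - 2 = q := by ring
    rw [h1] at hrec
    have h2 : q + 2 ≠ 0 := by linarith
    field_simp
    have h3 : (q + 2) * ((q + 2) * cosInt (q + 2) 0) = (q + 2) * ((q + 1) * cosInt q 0) := by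
      linear_combination hrec
    exact mul_left_cancel₀ h2 h3
  have hint : ∀ p : ℝ, 0 ≤ p → IntervalIntegrable
      (fun y => Real.exp (0 * y) * Real.cos y ^ p) volume (-(Real.pi / 2)) (Real.pi / 2) :=
    fun p hp => (continuous_exp_mul_cos_rpow hp 0).intervalIntegrable _ _
  have h4 : cosInt q s ≤ (1 + C) * cosInt q 0 - C * cosInt (q + 2) 0 := by
    rw [cosInt_eq_cosh hq, cosInt, cosInt, ← intervalIntegral.integral_const_mul,
      ← intervalIntegral.integral_const_mul, ← intervalIntegral.integral_sub
      ((hint q hq).const_mul _) ((hint (q + 2) (by linarith)).const_mul _)]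
    refine intervalIntegral.integral_mono_on (by linarith)
      (Continuous.intervalIntegrable (by fun_prop) _ _)
      (Continuous.intervalIntegrable (by fun_prop) _ _) fun y hy => ?_
    have hy0 := Real.cos_nonneg_of_mem_Icc hy
    have h5 : Real.cos y ^ (q + 2) = Real.cos y ^ q * Real.cos y ^ 2 := by
      rw [Real.rpow_add_of_nonneg hy0 hq (by norm_num), Real.rpow_two]
    rw [h5, zero_mul, Real.exp_zero]
    have h6 : 0 ≤ Real.cos y ^ q := by positivity
    refine (mul_le_mul_of_nonneg_right (h y hy) h6).trans (le_of_eq ?_)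
    linear_combination C * Real.cos y ^ q * Real.sin_sq_add_cos_sq y
  refine h4.trans (le_of_eq ?_)
  rw [hrec2]
  have h2 : q + 2 ≠ 0 := by linarith
  field_simp
  ring

lemma integral_betaPDFReal {α β : ℝ} (hα : 0 < α) (hβ : 0 < β) :
    ∫ x, betaPDFReal α β x = 1 := by
  have h := lintegral_betaPDF_eq_one hα hβ
  have hn : ∀ x, 0 ≤ betaPDFReal α β x := fun x => by
    unfold betaPDFReal
    split_ifs with hx
    · have := beta_pos hα hβ
      have h1 := hx.1
      have h2 : 0 < 1 - x := by linarith [hx.2]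
      positivity
    · exact le_rfl
  rw [integral_eq_lintegral_of_nonneg_ae (Eventually.of_forall hn)
    (measurable_betaPDFReal α β).aestronglyMeasurable]
  simp only [betaPDF] at h
  rw [h, ENNReal.toReal_one]

lemma image_cos_sq_Ioo :
    (fun y => Real.cos y ^ 2) '' Set.Ioo 0 (Real.pi / 2) = Set.Ioo (0 : ℝ) 1 := by
  have hpi := Real.pi_pos
  ext x
  constructor
  · rintro ⟨y, ⟨h1, h2⟩, rfl⟩
    have hc := Real.cos_pos_of_mem_Ioo (x := y) ⟨by linarith, h2⟩
    have hs := Real.sin_pos_of_pos_of_lt_pi h1 (by linarith)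
    exact ⟨by positivity, by nlinarith [Real.sin_sq_add_cos_sq y]⟩
  · rintro ⟨h1, h2⟩
    have h3 : 0 < Real.sqrt x := Real.sqrt_pos.mpr h1
    have h4 : Real.sqrt x < 1 := by rw [Real.sqrt_lt' one_pos]; simpa using h2
    refine ⟨Real.arccos (Real.sqrt x), ⟨Real.arccos_pos.mpr h4,
      Real.arccos_lt_pi_div_two.mpr h3⟩, ?_⟩
    simp only [Real.cos_arccos (by linarith) h4.le, Real.sq_sqrt h1.le]

/-- The substitution x = cos² y in the beta density with parameters a - 1/2 and 1/2, on the half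
interval where it is injective; symmetry supplies the other half. -/
lemma cosInt_zero {a : ℝ} (ha : 1 ≤ a) :
    cosInt (2 * (a - 1)) 0 = Real.Gamma (a - 1 / 2) * Real.Gamma (1 / 2) / Real.Gamma a := by
  have hpi := Real.pi_pos
  have hα : 0 < a - 1 / 2 := by linarith
  have hβ : (0 : ℝ) < 1 / 2 := by norm_num
  have hB := beta_pos hα hβ
  have h1 := integral_betaPDFReal hα hβ
  have hB' : beta (a - 1 / 2) (1 / 2) =
      Real.Gamma (a - 1 / 2) * Real.Gamma (1 / 2) / Real.Gamma a := by
    rw [beta]; congr 2; ring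
  rw [← hB']
  have h2 : ∫ x, betaPDFReal (a - 1 / 2) (1 / 2) x =
      ∫ x in Set.Ioo (0 : ℝ) 1, betaPDFReal (a - 1 / 2) (1 / 2) x := by
    rw [setIntegral_eq_integral_of_forall_compl_eq_zero]
    intro x hx
    rw [betaPDFReal, if_neg]
    exact hx
  rw [h2, ← image_cos_sq_Ioo, integral_image_eq_integral_abs_deriv_smul measurableSet_Ioo
    (f' := fun y => -(2 * Real.cos y * Real.sin y))
    (fun y _ => by
      refine (((Real.hasDerivAt_cos y).pow 2).congr_deriv ?_).hasDerivWithinAt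
      norm_num)
    (by
      intro x hx y hy hxy
      have hx' := Real.cos_pos_of_mem_Ioo (x := x) ⟨by linarith [hx.1], hx.2⟩
      have hy' := Real.cos_pos_of_mem_Ioo (x := y) ⟨by linarith [hy.1], hy.2⟩
      have hcos : Real.cos x = Real.cos y := (pow_left_inj₀ hx'.le hy'.le two_ne_zero).mp hxy
      exact Real.injOn_cos ⟨hx.1.le, by linarith [hx.2]⟩ ⟨hy.1.le, by linarith [hy.2]⟩ hcos)] at h1
  have h3 : ∫ y in Set.Ioo 0 (Real.pi / 2), |-(2 * Real.cos y * Real.sin y)| •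
      betaPDFReal (a - 1 / 2) (1 / 2) (Real.cos y ^ 2) =
      ∫ y in Set.Ioo 0 (Real.pi / 2), 2 / beta (a - 1 / 2) (1 / 2) *
        Real.cos y ^ (2 * (a - 1)) := by
    refine setIntegral_congr_fun measurableSet_Ioo fun y hy => ?_
    have hc := Real.cos_pos_of_mem_Ioo (x := y) ⟨by linarith [hy.1], hy.2⟩
    have hs := Real.sin_pos_of_pos_of_lt_pi hy.1 (by linarith [hy.2])
    have h01 : 0 < Real.cos y ^ 2 ∧ Real.cos y ^ 2 < 1 :=
      ⟨by positivity, by nlinarith [Real.sin_sq_add_cos_sq y]⟩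
    have e1 : 1 - Real.cos y ^ 2 = Real.sin y ^ 2 := by
      linear_combination -Real.sin_sq_add_cos_sq y
    have e2 : (Real.sin y ^ 2) ^ ((1 : ℝ) / 2 - 1) = (Real.sin y)⁻¹ := by
      rw [← Real.rpow_natCast, ← Real.rpow_mul hs.le, ← Real.rpow_neg_one]
      norm_num
    have e3 : (Real.cos y ^ 2) ^ (a - 1 / 2 - 1) = Real.cos y ^ (2 * (a - 1)) / Real.cos y := by
      rw [← Real.rpow_natCast, ← Real.rpow_mul hc.le, ← Real.rpow_sub_one hc.ne']
      congr 1
      push_cast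
      ring
    simp only [smul_eq_mul]
    rw [betaPDFReal, if_pos h01, abs_neg, abs_of_pos (by positivity), e1, e2, e3]
    field_simp
  rw [h3, integral_const_mul, ← integral_Ioc_eq_integral_Ioo,
    ← intervalIntegral.integral_of_le (by linarith)] at h1
  have hc : Continuous fun y => Real.cos y ^ (2 * (a - 1)) :=
    Real.continuous_cos.rpow_const fun _ => Or.inr (by linarith)
  have h4 : cosInt (2 * (a - 1)) 0 = 2 * ∫ y in (0 : ℝ)..(Real.pi / 2),
      Real.cos y ^ (2 * (a - 1)) := by
    have h5 := intervalIntegral.integral_comp_neg (a := 0) (b := Real.pi / 2)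
      fun y => Real.cos y ^ (2 * (a - 1))
    simp only [Real.cos_neg, neg_zero] at h5
    rw [cosInt, ← intervalIntegral.integral_add_adjacent_intervals
      (b := 0) ((continuous_exp_mul_cos_rpow (by linarith) 0).intervalIntegrable _ _)
      ((continuous_exp_mul_cos_rpow (by linarith) 0).intervalIntegrable _ _)]
    simp only [zero_mul, Real.exp_zero, one_mul]
    rw [← h5]
    ring
  rw [h4]
  rw [div_mul_eq_mul_div, div_eq_one_iff_eq hB.ne'] at h1
  exact h1

lemma gammaConst_add_one {a : ℝ} (ha : 1 ≤ a) (s : ℝ) :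
    gammaConst (a + 1) s * (a * (a - 1 / 2)) = (a ^ 2 + (s / 2) ^ 2) * gammaConst a s := by
  have ha0 : 0 < a := by linarith
  have h1 : 0 < a - 1 / 2 := by linarith
  have h2 : ((a + 1 : ℝ) : ℂ) - Complex.I * (s : ℂ) / 2 = gammaArg a s + 1 := by
    rw [gammaArg]; push_cast; ring
  have h3 : gammaArg a s ≠ 0 := ne_zero_of_re_pos (by rw [gammaArg_eq]; exact ha0)
  have h4 : a + 1 - 1 / 2 = (a - 1 / 2) + 1 := by ring
  have h5 := Real.Gamma_pos_of_pos ha0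
  have h6 := Real.Gamma_pos_of_pos h1
  have h7 := Real.Gamma_pos_of_pos (show (0 : ℝ) < 1 / 2 by norm_num)
  rw [gammaConst, gammaConst, h2, ← gammaArg, Complex.Gamma_add_one _ h3, h4,
    Real.Gamma_add_one ha0.ne', Real.Gamma_add_one h1.ne', norm_mul, mul_pow, norm_gammaArg,
    Real.sq_sqrt (by positivity)]
  generalize a - 1 / 2 = b at *
  field_simp

/-- The total mass of `h`. -/
def mass (a s : ℝ) : ℝ := gammaConst a s * cosInt (2 * (a - 1)) s

lemma mass_add_one {a : ℝ} (ha : 1 ≤ a) (s : ℝ) : mass (a + 1) s = mass a s := by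
  have h1 := gammaConst_add_one ha s
  have h2 := cosInt_recurrence (q := 2 * a) (by linarith) s
  have h3 : 2 * (a + 1 - 1) = 2 * a := by ring
  have h4 : 2 * (a - 1) = 2 * a - 2 := by ring
  have h5 : 0 < a * (a - 1 / 2) := by apply mul_pos <;> linarith
  rw [mass, mass, h3, h4]
  apply mul_left_cancel₀ h5.ne'
  -- The 1/4 reconciles s² + (2a)² with a² + (s/2)².
  linear_combination cosInt (2 * a) s * h1 + gammaConst a s / 4 * h2

lemma mass_add_nat {a : ℝ} (ha : 1 ≤ a) (s : ℝ) (n : ℕ) : mass (a + n) s = mass a s := by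
  induction n with
  | zero => simp
  | succ n ih =>
    push_cast
    rw [← add_assoc, mass_add_one (by linarith [n.cast_nonneg (α := ℝ)]), ih]

lemma mass_zero {a : ℝ} (ha : 1 ≤ a) : mass a 0 = 1 := by
  have h5 := Real.Gamma_pos_of_pos (show 0 < a by linarith)
  have h6 := Real.Gamma_pos_of_pos (show 0 < a - 1 / 2 by linarith)
  have h7 := Real.Gamma_pos_of_pos (show (0 : ℝ) < 1 / 2 by norm_num)
  rw [mass, cosInt_zero ha, gammaConst]
  simp only [Complex.ofReal_zero, mul_zero, zero_div, sub_zero]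
  rw [Complex.Gamma_ofReal, Complex.norm_real, Real.norm_eq_abs, abs_of_pos h5]
  generalize a - 1 / 2 = b at *
  field_simp

lemma tendsto_gammaConst_div {a : ℝ} (ha : 1 ≤ a) (s : ℝ) :
    Tendsto (fun n : ℕ => gammaConst (a + (n + 1)) s / gammaConst (a + (n + 1)) 0)
      atTop (𝓝 1) := by
  have ha0 : 0 < a := by linarith
  have h1 := tendsto_Gamma_add_nat_div (z := gammaArg a s) (by rw [gammaArg_eq]; exact ha0)
  have h2 := tendsto_Gamma_add_nat_div (z := (a : ℂ)) (by simpa)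
  have h3 := (h1.pow 2).div (h2.pow 2) (by norm_num)
  rw [one_pow, div_one] at h3
  refine h3.congr' ?_
  filter_upwards [eventually_gt_atTop 0] with n hn
  have hn' : (0 : ℝ) < n := by exact_mod_cast hn
  have hre : (gammaArg a s).re = a := by rw [gammaArg_eq]
  have e1 : ((a + (n + 1) : ℝ) : ℂ) - Complex.I * (s : ℂ) / 2 = gammaArg a s + (n + 1) := by
    rw [gammaArg]; push_cast; ring
  have e2 : ((a + (n + 1) : ℝ) : ℂ) - Complex.I * ((0 : ℝ) : ℂ) / 2 = (a : ℂ) + (n + 1) := by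
    push_cast; ring
  have h5 := Real.Gamma_pos_of_pos (show 0 < a + (n + 1) by positivity)
  have h6 := Real.Gamma_pos_of_pos (show 0 < a + (n + 1) - 1 / 2 by linarith)
  have h7 := Real.Gamma_pos_of_pos (show (0 : ℝ) < 1 / 2 by norm_num)
  rw [gammaConst, gammaConst, e1, e2, hre, Complex.ofReal_re]
  simp only [div_pow, Pi.div_apply]
  rw [div_div_div_cancel_right₀ (by positivity), div_div_div_cancel_right₀ (by positivity)]

theorem mass_eq_one {a : ℝ} (ha : 1 ≤ a) (s : ℝ) : mass a s = 1 := by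
  obtain ⟨C, hC⟩ := exists_cosInt_le s
  have hq : ∀ n : ℕ, 0 ≤ 2 * (a + ((n : ℝ) + 1) - 1) := fun n => by
    linarith [n.cast_nonneg (α := ℝ)]
  have h1 : Tendsto (fun n : ℕ => cosInt (2 * (a + ((n : ℝ) + 1) - 1)) s /
      cosInt (2 * (a + ((n : ℝ) + 1) - 1)) 0) atTop (𝓝 1) := by
    have hlim : Tendsto (fun n : ℕ => 1 + C / (2 * (a + ((n : ℝ) + 1) - 1) + 2))
        atTop (𝓝 1) := by
      have : Tendsto (fun n : ℕ => 2 * (a + ((n : ℝ) + 1) - 1) + 2) atTop atTop := by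
        refine tendsto_atTop_mono (fun n => ?_) (tendsto_natCast_atTop_atTop (R := ℝ))
        linarith [n.cast_nonneg (α := ℝ)]
      simpa using (tendsto_const_nhds.div_atTop this).const_add (1 : ℝ)
    refine tendsto_of_tendsto_of_tendsto_of_le_of_le tendsto_const_nhds hlim
      (fun n => ?_) fun n => ?_
    · show 1 ≤ _
      rw [one_le_div (cosInt_pos (hq n) 0)]
      exact cosInt_zero_le (hq n) s
    · show _ / _ ≤ _
      rw [div_le_iff₀' (cosInt_pos (hq n) 0)]
      exact hC _ (hq n)
  have h2 := (tendsto_gammaConst_div ha s).mul h1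
  rw [mul_one] at h2
  -- The product of the two ratios is the mass at a + n + 1 for s over that for 0; by periodicity
  -- and `mass_zero` it is constantly `mass a s`.
  refine tendsto_nhds_unique (tendsto_const_nhds.congr fun n => ?_) h2
  have h3 := mass_add_nat ha s (n + 1)
  have h4 := mass_zero (a := a + (n + 1)) (by linarith [n.cast_nonneg (α := ℝ)])
  push_cast at h3
  rw [← h3, div_mul_div_comm, ← mass, ← mass, h4, div_one]

/-! ### Unimodality and log-concavity of `h` -/

lemma h_of_abs_le {y : ℝ} (a s : ℝ) (hy : |y| ≤ Real.pi / 2) :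
    h a s y = gammaConst a s * (Real.exp (s * y) * Real.cos y ^ (2 * (a - 1))) := by
  have hc := Real.cos_nonneg_of_mem_Icc (abs_le.mp hy)
  rw [h, if_pos hy, ← Real.rpow_natCast (Real.cos y) 2, ← Real.rpow_mul hc, mul_assoc]
  push_cast
  rfl

lemma h_eq_indicator (a s : ℝ) : h a s = (Set.Icc (-(Real.pi / 2)) (Real.pi / 2)).indicator
    fun y => gammaConst a s * (Real.exp (s * y) * Real.cos y ^ (2 * (a - 1))) := by
  ext y
  by_cases hy : |y| ≤ Real.pi / 2
  · rw [h_of_abs_le a s hy, Set.indicator_of_mem (Set.mem_Icc.mpr (abs_le.mp hy))]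
  · rw [h, if_neg hy, Set.indicator_of_notMem fun hm => hy (abs_le.mpr (Set.mem_Icc.mp hm))]

lemma h_nonneg {a : ℝ} (ha : 1 ≤ a) (s y : ℝ) : 0 ≤ h a s y := by
  have := gammaConst_pos ha s
  unfold h
  split_ifs <;> positivity

lemma integrable_h {a : ℝ} (ha : 1 ≤ a) (s : ℝ) : Integrable (h a s) := by
  rw [h_eq_indicator, integrable_indicator_iff measurableSet_Icc]
  exact ((continuous_exp_mul_cos_rpow (by linarith) s).const_mul _).continuousOn.integrableOn_Icc

lemma measurable_h {a : ℝ} (ha : 1 ≤ a) (s : ℝ) : Measurable (h a s) := by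
  rw [h_eq_indicator]
  exact ((continuous_exp_mul_cos_rpow (by linarith) s).const_mul _).measurable.indicator
    measurableSet_Icc

lemma integral_h {a : ℝ} (ha : 1 ≤ a) (s : ℝ) : ∫ y, h a s y = 1 := by
  rw [← mass_eq_one ha s, mass, cosInt, ← intervalIntegral.integral_const_mul,
    intervalIntegral.integral_of_le (by linarith [Real.pi_pos]), ← integral_Icc_eq_integral_Ioc,
    h_eq_indicator, integral_indicator measurableSet_Icc]

lemma abs_mode_le (a s : ℝ) : |mode a s| ≤ Real.pi / 2 := by
  have hpi := Real.pi_pos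
  unfold mode
  split_ifs
  · rw [abs_of_pos (by positivity)]
  · exact abs_le.mpr ⟨(Real.neg_pi_div_two_lt_arctan _).le, (Real.arctan_lt_pi_div_two _).le⟩

lemma cos_mode_pos {a : ℝ} (ha : a ≠ 1) (s : ℝ) : 0 < Real.cos (mode a s) := by
  rw [mode, if_neg ha]
  exact Real.cos_arctan_pos _

lemma delta_pos (a s : ℝ) : 0 < delta a s := by
  unfold delta
  by_cases ha : a = 1
  · simp [ha, Real.exp_pos]
  · have := cos_mode_pos ha s
    positivity

lemma h_mode (a s : ℝ) : h a s (mode a s) = gammaConst a s * delta a s := by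
  rw [h, if_pos (abs_mode_le a s), delta, mul_assoc]

lemma h_mode_pos {a : ℝ} (ha : 1 ≤ a) (s : ℝ) : 0 < h a s (mode a s) := by
  rw [h_mode]
  exact mul_pos (gammaConst_pos ha s) (delta_pos a s)

/-- The graph of `cos` lies below its tangents on `[-π/2, π/2]`. -/
lemma cos_le_tangent {x m : ℝ} (hx : |x| ≤ Real.pi / 2) (hm : |m| ≤ Real.pi / 2) :
    Real.cos x ≤ Real.cos m - Real.sin m * (x - m) := by
  have hx' : x ∈ Set.Icc (-(Real.pi / 2)) (Real.pi / 2) := abs_le.mp hx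
  have hm' : m ∈ Set.Icc (-(Real.pi / 2)) (Real.pi / 2) := abs_le.mp hm
  have hcon := strictConcaveOn_cos_Icc.concaveOn
  have hd := Real.hasDerivAt_cos m
  rcases lt_trichotomy x m with hlt | rfl | hlt
  · have h1 := hcon.le_slope_of_hasDerivAt hx' hm' hlt hd
    rw [slope_def_field, le_div_iff₀ (by linarith)] at h1
    linarith
  · simp
  · have h1 := hcon.slope_le_of_hasDerivAt hm' hx' hlt hd
    rw [slope_def_field, div_le_iff₀ (by linarith)] at h1
    linarith

/-- For a > 1, the tangent bound and tan m = s/(2(a - 1)) give cos x ≤ cos m · e^{-(x - m) tan m};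
raised to the power 2(a - 1), the exponential exactly compensates e^{s(x - m)}. For a = 1 the
density is a truncated exponential with its maximum at π/2. -/
theorem h_le_h_mode {a s : ℝ} (ha : 1 ≤ a) (hs : 0 ≤ s) (x : ℝ) : h a s x ≤ h a s (mode a s) := by
  by_cases hx : |x| ≤ Real.pi / 2
  swap
  · rw [h, if_neg hx]
    exact (h_mode_pos ha s).le
  have hg := gammaConst_pos ha s
  rw [h_of_abs_le a s hx, h_of_abs_le a s (abs_mode_le a s)]
  refine mul_le_mul_of_nonneg_left ?_ hg.le
  by_cases ha1 : a = 1
  · subst ha1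
    have : x ≤ mode 1 s := by rw [mode, if_pos rfl]; exact (abs_le.mp hx).2
    simp only [sub_self, mul_zero, Real.rpow_zero, mul_one]
    gcongr
  · have ha2 : 0 < a - 1 := sub_pos.mpr (lt_of_le_of_ne ha (Ne.symm ha1))
    have hcm := cos_mode_pos ha1 s
    have hcx := Real.cos_nonneg_of_mem_Icc (abs_le.mp hx)
    set m := mode a s with hm
    have ht : Real.sin m = s / (2 * (a - 1)) * Real.cos m := by
      rw [hm, mode, if_neg ha1, ← Real.tan_mul_cos (Real.cos_arctan_pos _).ne', Real.tan_arctan]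
    have h1 : Real.cos x ≤ Real.cos m * Real.exp (-(s / (2 * (a - 1)) * (x - m))) := by
      refine (cos_le_tangent hx (abs_mode_le a s)).trans ?_
      rw [← hm, ht]
      nlinarith [mul_le_mul_of_nonneg_left (Real.add_one_le_exp (-(s / (2 * (a - 1)) * (x - m))))
        hcm.le]
    have h2 := Real.rpow_le_rpow hcx h1 (show 0 ≤ 2 * (a - 1) by linarith)
    rw [Real.mul_rpow hcm.le (Real.exp_pos _).le, ← Real.exp_mul] at h2
    have h3 : -(s / (2 * (a - 1)) * (x - m)) * (2 * (a - 1)) = s * m - s * x := by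
      field_simp; ring
    rw [h3] at h2
    calc Real.exp (s * x) * Real.cos x ^ (2 * (a - 1)) ≤
        Real.exp (s * x) * (Real.cos m ^ (2 * (a - 1)) * Real.exp (s * m - s * x)) := by gcongr
      _ = Real.exp (s * x) * Real.exp (s * m - s * x) * Real.cos m ^ (2 * (a - 1)) := by ring
      _ = _ := by rw [← Real.exp_add]; congr 2; ring

/-- The exponential factor is log-linear, and concavity of cos with the weighted AM-GM inequality
makes the other factor log-concave, including at endpoints where cos is 0. -/
lemma h_log_concave {a : ℝ} (ha : 1 ≤ a) (s : ℝ) {m x t : ℝ} (hm : |m| ≤ Real.pi / 2)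
    (hx : |x| ≤ Real.pi / 2) (ht0 : 0 ≤ t) (ht1 : t ≤ 1) :
    h a s m ^ (1 - t) * h a s x ^ t ≤ h a s (m + t * (x - m)) := by
  have hg := gammaConst_pos ha s
  have e : m + t * (x - m) = (1 - t) * m + t * x := by ring
  have hm' := abs_le.mp hm
  have hx' := abs_le.mp hx
  have hy : |m + t * (x - m)| ≤ Real.pi / 2 := by
    rw [e, abs_le]
    constructor <;> nlinarith
  have hcm := Real.cos_nonneg_of_mem_Icc hm'
  have hcx := Real.cos_nonneg_of_mem_Icc hx'
  have ht2 : 0 ≤ 1 - t := by linarith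
  have hcos : Real.cos m ^ (1 - t) * Real.cos x ^ t ≤ Real.cos (m + t * (x - m)) := by
    refine (Real.geom_mean_le_arith_mean2_weighted ht2 ht0 hcm hcx (by ring)).trans ?_
    have := strictConcaveOn_cos_Icc.concaveOn.2 hm' hx' ht2 ht0 (by ring)
    simp only [smul_eq_mul] at this
    rwa [e]
  rw [h_of_abs_le a s hm, h_of_abs_le a s hx, h_of_abs_le a s hy]
  have hp : 0 ≤ 2 * (a - 1) := by linarith
  rw [Real.mul_rpow hg.le (by positivity), Real.mul_rpow hg.le (by positivity),
    Real.mul_rpow (Real.exp_pos _).le (by positivity),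
    Real.mul_rpow (Real.exp_pos _).le (by positivity), ← Real.exp_mul, ← Real.exp_mul,
    ← Real.rpow_mul hcm, ← Real.rpow_mul hcx, mul_comm (2 * (a - 1)) (1 - t),
    mul_comm (2 * (a - 1)) t, Real.rpow_mul hcm, Real.rpow_mul hcx]
  have e1 : gammaConst a s ^ (1 - t) * gammaConst a s ^ t = gammaConst a s := by
    rw [← Real.rpow_add hg]; simp
  have e2 : Real.exp (s * m * (1 - t)) * Real.exp (s * x * t) =
      Real.exp (s * (m + t * (x - m))) := by
    rw [← Real.exp_add]; congr 1; ring
  have e3 : (Real.cos m ^ (1 - t)) ^ (2 * (a - 1)) * (Real.cos x ^ t) ^ (2 * (a - 1)) ≤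
      Real.cos (m + t * (x - m)) ^ (2 * (a - 1)) := by
    rw [← Real.mul_rpow (by positivity) (by positivity)]
    exact Real.rpow_le_rpow (by positivity) hcos hp
  calc _ = (gammaConst a s ^ (1 - t) * gammaConst a s ^ t) *
        ((Real.exp (s * m * (1 - t)) * Real.exp (s * x * t)) *
        ((Real.cos m ^ (1 - t)) ^ (2 * (a - 1)) * (Real.cos x ^ t) ^ (2 * (a - 1)))) := by ring
    _ ≤ _ := by
      rw [e1, e2]
      gcongr

/-- The exponential bound for a density that lies above the geometric interpolation of its values
at a mode `m` and at `x`. -/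
lemma le_mul_exp_of_log_concave {f : ℝ → ℝ} {m x : ℝ} (hf0 : ∀ y, 0 ≤ f y)
    (hfi : Integrable f) (hf1 : ∫ y, f y = 1) (hm : 0 < f m) (hxm : f x ≤ f m)
    (hlc : ∀ t ∈ Set.Icc (0 : ℝ) 1, f m ^ (1 - t) * f x ^ t ≤ f (m + t * (x - m))) :
    f x ≤ f m * Real.exp (1 - f m * |x - m|) := by
  -- The cases f(x) = 0 and x = m are removed first: the logarithm of f(x) and the rescaling by x -
  -- m are needed below.
  rcases (hf0 x).eq_or_lt with h0 | hx
  · rw [← h0]; positivity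
  rcases eq_or_ne x m with rfl | hne
  · simp only [sub_self, abs_zero, mul_zero, sub_zero]
    exact le_mul_of_one_le_right hm.le (Real.one_le_exp zero_le_one)
  have hd : x - m ≠ 0 := sub_ne_zero.mpr hne
  set r := Real.log (f m) - Real.log (f x) with hr
  have hr0 : 0 ≤ r := sub_nonneg.mpr (Real.log_le_log hx hxm)
  have hinterp : ∀ t, f m ^ (1 - t) * f x ^ t = f m * Real.exp (-r * t) := by
    intro t
    nth_rewrite 2 [← Real.exp_log hm]
    rw [Real.rpow_def_of_pos hm, Real.rpow_def_of_pos hx, ← Real.exp_add, ← Real.exp_add, hr]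
    congr 1; ring
  have hI : Integrable fun t => f (m + t * (x - m)) :=
    (hfi.comp_add_left m).comp_mul_right' hd
  have hItot : ∫ t, f (m + t * (x - m)) = |x - m|⁻¹ := by
    rw [Measure.integral_comp_mul_right (fun y => f (m + y)) (x - m),
      integral_add_left_eq_self, hf1, smul_eq_mul, mul_one, abs_inv]
  -- The mass of f over the segment from m to x is at most 1, while f is at least f(m) e^{-rt}
  -- there.
  have hle : f m * ∫ t in (0 : ℝ)..1, Real.exp (-r * t) ≤ |x - m|⁻¹ := by
    rw [← hItot, ← intervalIntegral.integral_const_mul,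
      intervalIntegral.integral_of_le zero_le_one, ← integral_Icc_eq_integral_Ioc]
    refine le_trans ?_ (setIntegral_le_integral (s := Set.Icc 0 1) hI
      (Eventually.of_forall fun t => hf0 _))
    refine setIntegral_mono_on (Continuous.integrableOn_Icc (by fun_prop)) hI.integrableOn
      measurableSet_Icc fun t ht => ?_
    rw [← hinterp]
    exact hlc t ht
  -- For r > 0 this is (1 + r)(1 - e^{-r}) ≥ r, that is (1 + r)e^{-r} ≤ 1. Together with the mass
  -- bound it gives f(m)|x - m| ≤ 1 + r.
  have hJ : 1 ≤ (1 + r) * ∫ t in (0 : ℝ)..1, Real.exp (-r * t) := by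
    rcases hr0.eq_or_lt with h0 | hrpos
    · rw [← h0]; simp
    · rw [intervalIntegral.integral_comp_mul_left (fun t => Real.exp t)
        (neg_ne_zero.mpr hrpos.ne'), integral_exp]
      have h1 := Real.add_one_le_exp r
      have h2 : Real.exp (-r) * Real.exp r = 1 := by rw [← Real.exp_add]; simp
      have h3 : (1 + r) * Real.exp (-r) ≤ 1 := by nlinarith [Real.exp_pos (-r)]
      have h4 : (1 + r) * ((-r)⁻¹ * (Real.exp (-r * 1) - Real.exp (-r * 0))) =
          (1 + r) * (1 - Real.exp (-r)) / r := by
        simp only [mul_one, mul_zero, Real.exp_zero]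
        field_simp
        ring
      rw [smul_eq_mul, h4, le_div_iff₀ hrpos]
      linarith
  have hdpos : 0 < |x - m| := abs_pos.mpr hd
  have hkey : f m * |x - m| ≤ 1 + r := by
    set J := ∫ t in (0 : ℝ)..1, Real.exp (-r * t)
    have h5 : f m * |x - m| * J ≤ 1 := by
      calc f m * |x - m| * J = (f m * J) * |x - m| := by ring
        _ ≤ |x - m|⁻¹ * |x - m| := by gcongr
        _ = 1 := inv_mul_cancel₀ hdpos.ne'
    have hJ0 : 0 < J := by
      by_contra hcon
      nlinarith
    by_contra hcon
    nlinarith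
  have hfx : f x = f m * Real.exp (-r) := by
    have := hinterp 1
    simpa using this
  rw [hfx]
  gcongr
  linarith

theorem h_le_bounding {a s L : ℝ} (ha : 1 ≤ a) (hs : 0 ≤ s) (hL : L ≤ h a s (mode a s)) (x : ℝ) :
    h a s x ≤ bounding (h a s) (mode a s) L x := by
  have hm := h_mode_pos ha s
  refine le_min (h_le_h_mode ha hs x) ?_
  by_cases hx : |x| ≤ Real.pi / 2
  · refine (le_mul_exp_of_log_concave (h_nonneg ha s) (integrable_h ha s) (integral_h ha s) hm
      (h_le_h_mode ha hs x) fun t ht => h_log_concave ha s (abs_mode_le a s) hx ht.1 ht.2).trans ?_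
    gcongr
  · rw [h, if_neg hx]
    positivity

/-! ### The expected number of iterations of the rejection algorithm -/

/-- The tail-sum formula: the n-th summand records that the first n trials fail, the term n = 0
being always 1. If no trial succeeds both sides are ∞. The expectation then becomes a geometric
series. -/
lemma iInf_index_eq_tsum {Ω : Type*} (A : Set Ω) (ω : ℕ → Ω) :
    (⨅ (n : ℕ) (_ : ω n ∈ A), ((n : ℝ≥0∞) + 1)) =
      ∑' n : ℕ, (Set.pi (Finset.range n : Set ℕ) fun _ => Aᶜ).indicator (fun _ => 1) ω := by
  classical
  by_cases hex : ∃ n, ω n ∈ A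
  · have hlt : ∀ n, ω ∈ Set.pi (Finset.range n : Set ℕ) (fun _ => Aᶜ) ↔ n < Nat.find hex + 1 := by
      intro n
      rw [Nat.lt_succ_iff, Nat.le_find_iff, Set.mem_pi]
      simp
    have h1 : (⨅ (n : ℕ) (_ : ω n ∈ A), ((n : ℝ≥0∞) + 1)) = (Nat.find hex : ℝ≥0∞) + 1 := by
      refine le_antisymm (iInf₂_le_of_le _ (Nat.find_spec hex) le_rfl) (le_iInf₂ fun n hn => ?_)
      gcongr
      exact Nat.find_min' hex hn
    rw [h1, tsum_eq_sum (s := Finset.range (Nat.find hex + 1))]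
    · rw [Finset.sum_congr rfl fun n hn =>
        Set.indicator_of_mem ((hlt n).mpr (Finset.mem_range.mp hn)) _]
      simp
    · intro n hn
      rw [Set.indicator_of_notMem]
      rw [hlt]
      simpa using hn
  · have hno : ∀ n, ω n ∉ A := fun n hn => hex ⟨n, hn⟩
    have h1 : ∀ n : ℕ, (Set.pi (Finset.range n : Set ℕ) fun _ => Aᶜ).indicator
        (fun _ => (1 : ℝ≥0∞)) ω = 1 := fun n =>
      Set.indicator_of_mem (Set.mem_pi.mpr fun k _ => hno k) _
    simp only [h1, hno, iInf_false, iInf_top]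
    exact (ENNReal.tsum_const_eq_top_of_ne_zero one_ne_zero).symm

/-- The mean of the geometric distribution: the expected index of the first success. -/
theorem lintegral_iInf_index {Ω : Type*} [MeasurableSpace Ω] (P : Measure Ω)
    [IsProbabilityMeasure P] {A : Set Ω} (hA : MeasurableSet A) :
    ∫⁻ ω, (⨅ (n : ℕ) (_ : ω n ∈ A), ((n : ℝ≥0∞) + 1)) ∂(Measure.infinitePi fun _ : ℕ => P) =
      (P A)⁻¹ := by
  have hms : ∀ n : ℕ, MeasurableSet (Set.pi (Finset.range n : Set ℕ) fun _ => Aᶜ) := fun n =>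
    MeasurableSet.pi (Finset.countable_toSet _) fun _ _ => hA.compl
  simp only [iInf_index_eq_tsum]
  rw [lintegral_tsum fun n => (measurable_const.indicator (hms n)).aemeasurable]
  have h1 : ∀ n : ℕ, ∫⁻ ω, (Set.pi (Finset.range n : Set ℕ) fun _ => Aᶜ).indicator
      (fun _ => (1 : ℝ≥0∞)) ω ∂(Measure.infinitePi fun _ : ℕ => P) = (1 - P A) ^ n := by
    intro n
    rw [lintegral_indicator (hms n), setLIntegral_const, one_mul,
      Measure.infinitePi_pi _ fun _ _ => hA.compl]
    simp [prob_compl_eq_one_sub hA]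
  simp only [h1]
  rw [ENNReal.tsum_geometric, ENNReal.sub_sub_cancel ENNReal.one_ne_top prob_le_one]

/-- The envelope `min (1, e^{1 - |t|})`. -/
def envelope (t : ℝ) : ℝ := min 1 (Real.exp (1 - |t|))

lemma envelope_pos (t : ℝ) : 0 < envelope t := lt_min one_pos (Real.exp_pos _)

lemma measurable_envelope : Measurable envelope := by
  unfold envelope; fun_prop

lemma measurable_transformV : Measurable transformV := by
  unfold transformV
  refine Measurable.ite (measurableSet_lt measurable_id measurable_const) (by fun_prop) ?_
  exact Measurable.ite (measurableSet_lt measurable_const measurable_id) (by fun_prop)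
    measurable_id

lemma lintegral_split_three (S T U : Set ℝ) (hT : MeasurableSet T) (hU : MeasurableSet U)
    (h1 : Disjoint (S ∪ T) U) (h2 : Disjoint S T) (G : ℝ → ℝ≥0∞) :
    ∫⁻ x in (S ∪ T) ∪ U, G x = (∫⁻ x in S, G x) + (∫⁻ x in T, G x) + ∫⁻ x in U, G x := by
  rw [lintegral_union hU h1, lintegral_union hT h2]

/-- The transformed uniform variate has density proportional to the envelope. -/
theorem lintegral_transformV (G : ℝ → ℝ≥0∞) :
    ∫⁻ v in Set.Icc (-2 : ℝ) 2, G (transformV v) = ∫⁻ t, ENNReal.ofReal (envelope t) * G t := by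
  have hL : (fun t : ℝ => Real.exp (t + 1) - 2) '' Set.Iio (-1) = Set.Ioo (-2) (-1) := by
    ext v
    constructor
    · rintro ⟨t, ht, rfl⟩
      have h1 : Real.exp (t + 1) < 1 := Real.exp_lt_one_iff.mpr (by linarith [Set.mem_Iio.mp ht])
      exact ⟨by linarith [Real.exp_pos (t + 1)], by linarith⟩
    · rintro ⟨h1, h2⟩
      refine ⟨Real.log (v + 2) - 1, ?_, ?_⟩
      · have := Real.log_neg (x := v + 2) (by linarith) (by linarith)
        exact Set.mem_Iio.mpr (by linarith)
      · simp only [sub_add_cancel]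
        rw [Real.exp_log (by linarith)]; ring
  have hR : (fun t : ℝ => 1 + Real.exp (1 - t)) '' Set.Ioi 1 = Set.Ioo 1 2 := by
    ext v
    constructor
    · rintro ⟨t, ht, rfl⟩
      have h1 : Real.exp (1 - t) < 1 := Real.exp_lt_one_iff.mpr (by linarith [Set.mem_Ioi.mp ht])
      exact ⟨by linarith [Real.exp_pos (1 - t)], by linarith⟩
    · rintro ⟨h1, h2⟩
      refine ⟨1 - Real.log (v - 1), ?_, ?_⟩
      · have := Real.log_neg (x := v - 1) (by linarith) (by linarith)
        exact Set.mem_Ioi.mpr (by linarith)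
      · simp only [sub_sub_cancel]
        rw [Real.exp_log (by linarith)]; ring
  have eL : ∫⁻ v in Set.Ioo (-2 : ℝ) (-1), G (transformV v) =
      ∫⁻ t in Set.Iio (-1 : ℝ), ENNReal.ofReal (envelope t) * G t := by
    rw [← hL, lintegral_image_eq_lintegral_abs_deriv_mul measurableSet_Iio
      (f' := fun t => Real.exp (t + 1))
      (fun t _ => by
        simpa using ((((hasDerivAt_id t).add_const 1).exp).sub_const 2).hasDerivWithinAt)
      (fun x _ y _ hxy => by simpa using hxy)]
    refine setLIntegral_congr_fun measurableSet_Iio fun t ht => ?_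
    have ht' : t < -1 := ht
    have h1 : Real.exp (t + 1) < 1 := Real.exp_lt_one_iff.mpr (by linarith)
    have h2 : transformV (Real.exp (t + 1) - 2) = t := by
      rw [transformV, if_pos (by linarith), sub_add_cancel, Real.log_exp]; ring
    have h3 : envelope t = Real.exp (t + 1) := by
      rw [envelope, abs_of_neg (by linarith), sub_neg_eq_add, add_comm, min_eq_right h1.le]
    simp only [h2, h3, abs_of_pos (Real.exp_pos _)]
  have eR : ∫⁻ v in Set.Ioo (1 : ℝ) 2, G (transformV v) =
      ∫⁻ t in Set.Ioi (1 : ℝ), ENNReal.ofReal (envelope t) * G t := by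
    rw [← hR, lintegral_image_eq_lintegral_abs_deriv_mul measurableSet_Ioi
      (f' := fun t => -Real.exp (1 - t))
      (fun t _ => by
        simpa using ((((hasDerivAt_id t).const_sub 1).exp).const_add 1).hasDerivWithinAt)
      (fun x _ y _ hxy => by simpa using hxy)]
    refine setLIntegral_congr_fun measurableSet_Ioi fun t ht => ?_
    have ht' : 1 < t := ht
    have h1 : Real.exp (1 - t) < 1 := Real.exp_lt_one_iff.mpr (by linarith)
    have h0 := Real.exp_pos (1 - t)
    have h2 : transformV (1 + Real.exp (1 - t)) = t := by
      rw [transformV, if_neg (by linarith), if_pos (by linarith), add_sub_cancel_left,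
        Real.log_exp]
      ring
    have h3 : envelope t = Real.exp (1 - t) := by
      rw [envelope, abs_of_pos (by linarith), min_eq_right h1.le]
    simp only [h2, h3, abs_neg, abs_of_pos (Real.exp_pos _)]
  have eM : ∫⁻ v in Set.Icc (-1 : ℝ) 1, G (transformV v) =
      ∫⁻ t in Set.Icc (-1 : ℝ) 1, ENNReal.ofReal (envelope t) * G t := by
    refine setLIntegral_congr_fun measurableSet_Icc fun t ht => ?_
    have h2 : transformV t = t := by
      rw [transformV, if_neg (by linarith [ht.1]), if_neg (by linarith [ht.2])]
    have h3 : envelope t = 1 := by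
      rw [envelope, min_eq_left]
      exact Real.one_le_exp (by linarith [abs_le.mpr ht])
    simp only [h2, h3, ENNReal.ofReal_one, one_mul]
  have hs1 : Set.Ioo (-2 : ℝ) 2 = (Set.Ioo (-2) (-1) ∪ Set.Icc (-1) 1) ∪ Set.Ioo 1 2 := by
    ext x
    simp only [Set.mem_union, Set.mem_Ioo, Set.mem_Icc]
    constructor
    · rintro ⟨h1, h2⟩
      rcases lt_or_ge x (-1) with h | h
      · exact Or.inl (Or.inl ⟨h1, h⟩)
      · rcases le_or_gt x 1 with h' | h'
        · exact Or.inl (Or.inr ⟨h, h'⟩)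
        · exact Or.inr ⟨h', h2⟩
    · rintro ((⟨h1, h2⟩ | ⟨h1, h2⟩) | ⟨h1, h2⟩) <;> constructor <;> linarith
  have hs2 : (Set.univ : Set ℝ) = (Set.Iio (-1) ∪ Set.Icc (-1) 1) ∪ Set.Ioi 1 := by
    ext x
    simp only [Set.mem_univ, Set.mem_union, Set.mem_Iio, Set.mem_Icc, Set.mem_Ioi, true_iff]
    rcases lt_or_ge x (-1) with h | h
    · exact Or.inl (Or.inl h)
    · rcases le_or_gt x 1 with h' | h'
      · exact Or.inl (Or.inr ⟨h, h'⟩)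
      · exact Or.inr h'
  -- The endpoints ±2 form a null set; discarding them also avoids log 0 at v = -2.
  rw [← setLIntegral_congr Ioo_ae_eq_Icc, hs1, lintegral_split_three _ _ _ measurableSet_Icc
      measurableSet_Ioo, eL, eM, eR,
    ← setLIntegral_univ (μ := volume) (fun t => ENNReal.ofReal (envelope t) * G t), hs2,
    lintegral_split_three _ _ _ measurableSet_Icc measurableSet_Ioi]
  all_goals
    rw [Set.disjoint_left]
    intro x hx hx'
    simp only [Set.mem_union, Set.mem_Iio, Set.mem_Icc, Set.mem_Ioi, Set.mem_Ioo] at hx hx'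
    grind

/-- The change of variables applied to the constant 1: the 4 is the length of [-2, 2]. -/
lemma lintegral_envelope : ∫⁻ t, ENNReal.ofReal (envelope t) = 4 := by
  have h := lintegral_transformV fun _ => 1
  simp only [mul_one, setLIntegral_const, one_mul, Real.volume_Icc] at h
  rw [← h]
  norm_num

lemma bounding_eq {f : ℝ → ℝ} {m : ℝ} (hm : 0 < f m) {L : ℝ} (hL : 0 < L) (x : ℝ) :
    bounding f m L x = f m * envelope ((x - m) * L) := by
  rw [bounding, envelope, mul_min_of_nonneg _ _ hm.le, mul_one, abs_mul, abs_of_pos hL,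
    mul_comm L]

theorem lintegral_bounding {f : ℝ → ℝ} {m : ℝ} (hm : 0 < f m) {L : ℝ} (hL : 0 < L) :
    ∫⁻ x, ENNReal.ofReal (bounding f m L x) = ENNReal.ofReal (4 * (f m / L)) := by
  have hi : Integrable envelope := by
    refine ⟨measurable_envelope.aestronglyMeasurable, ?_⟩
    rw [hasFiniteIntegral_iff_ofReal (Eventually.of_forall fun t => (envelope_pos t).le),
      lintegral_envelope]
    exact ENNReal.ofNat_lt_top
  have h4 : ∫ t, envelope t = 4 := by
    rw [integral_eq_lintegral_of_nonneg_ae (Eventually.of_forall fun t => (envelope_pos t).le)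
      measurable_envelope.aestronglyMeasurable, lintegral_envelope]
    simp
  simp only [bounding_eq hm hL]
  have hi2 : Integrable fun x => f m * envelope ((x - m) * L) :=
    (((hi.comp_mul_right' hL.ne').comp_sub_right m)).const_mul _
  rw [← ofReal_integral_eq_lintegral_ofReal hi2
    (Eventually.of_forall fun t => by have := envelope_pos ((t - m) * L); positivity),
    integral_const_mul, integral_sub_right_eq_self (fun x => envelope (x * L)) m,
    Measure.integral_comp_mul_right, h4, abs_of_pos (by positivity), smul_eq_mul]
  congr 1
  ring

lemma cond_Icc_zero_one_setOf_mul_le {q r : ℝ} (hq : 0 < q) (hrq : r ≤ q) :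
    (cond volume (Set.Icc (0 : ℝ) 1)) {u | u * q ≤ r} = ENNReal.ofReal (r / q) := by
  have hset : Set.Icc (0 : ℝ) 1 ∩ {u | u * q ≤ r} = Set.Icc 0 (r / q) := by
    ext u
    simp only [Set.mem_inter_iff, Set.mem_Icc, Set.mem_ofPred_eq, le_div_iff₀ hq]
    constructor
    · rintro ⟨⟨h1, _⟩, h2⟩
      exact ⟨h1, h2⟩
    · rintro ⟨h1, h2⟩
      exact ⟨⟨h1, by nlinarith⟩, h2⟩
  rw [cond_apply measurableSet_Icc, hset, Real.volume_Icc, Real.volume_Icc]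
  simp

lemma measurableSet_accepts {f : ℝ → ℝ} (hf : Measurable f) (m L : ℝ) :
    MeasurableSet {p : ℝ × ℝ | Accepts f m L p} := by
  have hT := measurable_transformV
  unfold Accepts proposal
  refine measurableSet_le ?_ ?_ <;> fun_prop

theorem iterationLaw_accepts {f : ℝ → ℝ} {m L : ℝ} (hf : Measurable f) (hf0 : ∀ y, 0 ≤ f y)
    (hfi : Integrable f) (hf1 : ∫ y, f y = 1) (hm : 0 < f m) (hL : 0 < L)
    (hb : ∀ x, f x ≤ bounding f m L x) :
    iterationLaw {p | Accepts f m L p} = ENNReal.ofReal (L / (4 * f m)) := by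
  have hacc : ∀ v : ℝ, (cond volume (Set.Icc (0 : ℝ) 1))
      (Prod.mk v ⁻¹' {p : ℝ × ℝ | Accepts f m L p}) =
      ENNReal.ofReal (f (m + transformV v / L) / f m / envelope (transformV v)) := by
    intro v
    set t := transformV v with ht
    have h1 : L * |m + t / L - m| = |t| := by
      rw [add_sub_cancel_left, abs_div, abs_of_pos hL]; field_simp
    have h2 : Prod.mk v ⁻¹' {p : ℝ × ℝ | Accepts f m L p} =
        {u : ℝ | u * envelope t ≤ f (m + t / L) / f m} := by
      ext u
      simp only [Set.mem_preimage, Set.mem_ofPred_eq, Accepts, proposal, ← ht, h1, envelope]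
    -- Domination by the bounding function makes the acceptance ratio at most 1, so the uniform
    -- variate accepts with exactly that probability.
    have h3 : f (m + t / L) ≤ f m * envelope t := by
      refine (hb _).trans (le_of_eq ?_)
      rw [bounding_eq hm hL]
      congr 2
      field_simp
      ring
    rw [h2]
    refine cond_Icc_zero_one_setOf_mul_le (envelope_pos t) ?_
    rw [div_le_iff₀' hm]
    exact h3
  have hi : Integrable fun t => f (m + t / L) / f m :=
    ((hfi.comp_add_left m).comp_div hL.ne').div_const _
  have hint : ∫ t, f (m + t / L) / f m = L / f m := by
    rw [integral_div, Measure.integral_comp_div (fun y => f (m + y)) L,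
      integral_add_left_eq_self, hf1, abs_of_pos hL, smul_eq_mul, mul_one]
  have hP : IsProbabilityMeasure (cond volume (Set.Icc (0 : ℝ) 1)) :=
    cond_isProbabilityMeasure_of_finite (by simp) (by simp)
  rw [iterationLaw, Measure.prod_apply (measurableSet_accepts hf m L)]
  simp only [hacc]
  rw [ProbabilityTheory.cond, lintegral_smul_measure,
    lintegral_transformV fun t => ENNReal.ofReal (f (m + t / L) / f m / envelope t)]
  -- The envelope is both the proposal density up to a factor and the denominator of the acceptance
  -- ratio; after cancellation only the integral of f remains.
  have h5 : ∀ t, ENNReal.ofReal (envelope t) *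
      ENNReal.ofReal (f (m + t / L) / f m / envelope t) = ENNReal.ofReal (f (m + t / L) / f m) := by
    intro t
    rw [← ENNReal.ofReal_mul (envelope_pos t).le, mul_div_cancel₀ _ (envelope_pos t).ne']
  simp only [h5]
  rw [← ofReal_integral_eq_lintegral_ofReal hi
    (Eventually.of_forall fun t => div_nonneg (hf0 _) hm.le), hint, Real.volume_Icc, smul_eq_mul,
    ← ENNReal.ofReal_inv_of_pos (by norm_num), ← ENNReal.ofReal_mul (by norm_num)]
  congr 1
  field_simp
  norm_num

theorem expectedIterations_eq {f : ℝ → ℝ} {m L : ℝ} (hf : Measurable f) (hf0 : ∀ y, 0 ≤ f y)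
    (hfi : Integrable f) (hf1 : ∫ y, f y = 1) (hm : 0 < f m) (hL : 0 < L)
    (hb : ∀ x, f x ≤ bounding f m L x) :
    expectedIterations f m L = ENNReal.ofReal (4 * (f m / L)) := by
  have h := lintegral_iInf_index iterationLaw (measurableSet_accepts hf m L)
  rw [iterationLaw_accepts hf hf0 hfi hf1 hm hL hb,
    ← ENNReal.ofReal_inv_of_pos (by positivity)] at h
  rw [expectedIterations]
  simp only [iterations]
  refine h.trans ?_
  congr 1
  field_simp

/-! ### The explicit bounds -/

lemma chosenL_pos {a : ℝ} (ha : 1 ≤ a) (s : ℝ) : 0 < chosenL a s :=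
  mul_pos (gammaLower_pos ha s) (delta_pos a s)

lemma chosenL_le {a : ℝ} (ha : 1 ≤ a) (s : ℝ) : chosenL a s ≤ h a s (mode a s) := by
  rw [h_mode, chosenL]
  exact mul_le_mul_of_nonneg_right (gammaLower_le ha s) (delta_pos a s).le

lemma expectedIterations_h {a s L : ℝ} (ha : 1 ≤ a) (hs : 0 ≤ s) (hL0 : 0 < L)
    (hL : L ≤ h a s (mode a s)) :
    expectedIterations (h a s) (mode a s) L = ENNReal.ofReal (4 * (h a s (mode a s) / L)) :=
  expectedIterations_eq (measurable_h ha s) (h_nonneg ha s) (integrable_h ha s) (integral_h ha s)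
    (h_mode_pos ha s) hL0 (h_le_bounding ha hs hL)

lemma h_mode_div_chosenL (a s : ℝ) :
    h a s (mode a s) / chosenL a s = gammaConst a s / gammaLower a s := by
  rw [h_mode, chosenL, mul_div_mul_right _ _ (delta_pos a s).ne']

/-- `gammaStar` cancels, and the factors a and a + 1/2 cancel under the square root. -/
lemma gammaUpper_div_gammaLower {a : ℝ} (ha : 1 ≤ a) (s : ℝ) :
    4 * (gammaUpper a s / gammaLower a s) = explicitBound a s := by
  have ha0 : 0 < a := by linarith
  have hg := gammaStar_pos ha s
  have he : 0 < 1 - err a s := by linarith [err_lt_one ha s]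
  have hratio : (a + 0.177) * (a + 0.677) / ((a + 1 / 6) * (a + 2 / 3)) =
      (1 + 0.177 / a) * (1 + 0.177 / (a + 1 / 2)) /
        ((1 + 1 / (6 * a)) * (1 + 1 / (6 * (a + 1 / 2)))) := by
    have e1 : 1 + 0.177 / a = (a + 0.177) / a := by field_simp
    have e2 : 1 + 0.177 / (a + 1 / 2) = (a + 0.677) / (a + 1 / 2) := by
      rw [eq_div_iff (by positivity), add_mul, div_mul_cancel₀ _ (by positivity)]
      norm_num
      ring
    have e3 : 1 + 1 / (6 * a) = (a + 1 / 6) / a := by field_simp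
    have e4 : 1 + 1 / (6 * (a + 1 / 2)) = (a + 2 / 3) / (a + 1 / 2) := by
      have hb : 0 < a + 1 / 2 := by positivity
      rw [show a + 2 / 3 = a + 1 / 2 + 1 / 6 by ring]
      generalize a + 1 / 2 = b at *
      field_simp
    rw [e1, e2, e3, e4, div_mul_div_comm, div_mul_div_comm,
      div_div_div_cancel_right₀ (by positivity)]
  rw [explicitBound, hratio, gammaUpper, gammaLower, mul_div_mul_left _ _ hg.ne',
    Real.sqrt_div (by positivity), Real.sqrt_mul (by positivity), Real.sqrt_mul (by positivity)]
  have h1 : 0 < Real.sqrt (1 + 0.177 / a) := Real.sqrt_pos.mpr (by positivity)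
  have h2 : 0 < Real.sqrt (1 + 0.177 / (a + 1 / 2)) := Real.sqrt_pos.mpr (by positivity)
  have h3 : 0 < Real.sqrt (1 + 1 / (6 * a)) := Real.sqrt_pos.mpr (by positivity)
  have h4 : 0 < Real.sqrt (1 + 1 / (6 * (a + 1 / 2))) := Real.sqrt_pos.mpr (by positivity)
  generalize Real.sqrt (1 + 0.177 / a) = w1 at *
  generalize Real.sqrt (1 + 0.177 / (a + 1 / 2)) = w2 at *
  generalize Real.sqrt (1 + 1 / (6 * a)) = w3 at *
  generalize Real.sqrt (1 + 1 / (6 * (a + 1 / 2))) = w4 at *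
  field_simp

lemma one_add_div_one_sub_le {x y : ℝ} (hx : 0 ≤ x) (hxy : x ≤ y) (hy : y < 1) :
    ((1 + x) / (1 - x)) ^ 2 ≤ ((1 + y) / (1 - y)) ^ 2 := by
  have h1 : 0 < 1 - y := by linarith
  have h2 : 0 < 1 - x := by linarith
  have h3 : 0 ≤ 1 + y := by linarith
  gcongr

lemma uniformBound_eq : uniformBound =
    4 * ((1 + 3 / (2 * Real.pi ^ 2)) / (1 - 3 / (2 * Real.pi ^ 2))) ^ 2 *
      Real.sqrt (1.177 * 1.677 * 18 / 35) := by
  have hpi : 0 < 2 * Real.pi ^ 2 := by have := Real.pi_pos; positivity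
  have e1 : 1 + 3 / (2 * Real.pi ^ 2) = (2 * Real.pi ^ 2 + 3) / (2 * Real.pi ^ 2) := by
    rw [add_div, div_self hpi.ne']
  have e2 : 1 - 3 / (2 * Real.pi ^ 2) = (2 * Real.pi ^ 2 - 3) / (2 * Real.pi ^ 2) := by
    rw [sub_div, div_self hpi.ne']
  rw [uniformBound, e1, e2, div_div_div_cancel_right₀ hpi.ne']

lemma explicitBound_le_uniformBound {a : ℝ} (ha : 1 ≤ a) (s : ℝ) :
    explicitBound a s ≤ uniformBound := by
  have ha0 : 0 < a := by linarith
  have h1 := one_add_div_one_sub_le (err_pos ha s).le (err_le_const ha s)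
    (by linarith [three_div_two_pi_sq_le])
  -- The right side is the value at a = 1, the worst case.
  have h2 : (a + 0.177) * (a + 0.677) / ((a + 1 / 6) * (a + 2 / 3)) ≤
      1.177 * 1.677 * 18 / 35 := by
    rw [div_le_iff₀ (by positivity)]
    norm_num
    nlinarith
  rw [uniformBound_eq, explicitBound]
  gcongr

lemma abs_uniformBound_sub_lt : |uniformBound - 7.44| < 0.005 := by
  have hp1 := Real.pi_gt_d4
  have hp2 := Real.pi_lt_d4
  set r := (2 * Real.pi ^ 2 + 3) / (2 * Real.pi ^ 2 - 3) with hr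
  have hden : 0 < 2 * Real.pi ^ 2 - 3 := by nlinarith
  have hr1 : 1.3584 ≤ r := by
    rw [hr, le_div_iff₀ hden]; nlinarith
  have hr2 : r ≤ 1.3585 := by
    rw [hr, div_le_iff₀ hden]; nlinarith
  set w := Real.sqrt (1.177 * 1.677 * 18 / 35) with hw
  have hw1 : 1.0075 ≤ w := Real.le_sqrt_of_sq_le (by norm_num)
  have hw2 : w ≤ 1.0076 := by
    rw [hw, Real.sqrt_le_left (by norm_num)]; norm_num
  have hu : uniformBound = 4 * r ^ 2 * w := rfl
  have hrs1 : 1.3584 ^ 2 ≤ r ^ 2 := by gcongr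
  have hrs2 : r ^ 2 ≤ 1.3585 ^ 2 := by gcongr
  have h1 : 4 * 1.3584 ^ 2 * 1.0075 ≤ uniformBound := by rw [hu]; gcongr
  have h2 : uniformBound ≤ 4 * 1.3585 ^ 2 * 1.0076 := by rw [hu]; gcongr
  rw [abs_lt]
  norm_num at h1 h2 ⊢
  constructor <;> linarith

/-- An upper bound of `explicitBound a s` that does not depend on `s`. -/
def limitBound (a : ℝ) : ℝ :=
  4 * ((1 + 3 / (2 * Real.pi ^ 2) / a) / (1 - 3 / (2 * Real.pi ^ 2) / a)) ^ 2 *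
    Real.sqrt ((a + 0.177) / (a + 1 / 6) * ((a + 0.677) / (a + 2 / 3)))

lemma explicitBound_le_limitBound {a : ℝ} (ha : 1 ≤ a) (s : ℝ) :
    explicitBound a s ≤ limitBound a := by
  have hlt : 3 / (2 * Real.pi ^ 2) / a < 1 :=
    (div_le_self (by positivity) ha).trans_lt (by linarith [three_div_two_pi_sq_le])
  have h1 := one_add_div_one_sub_le (err_pos ha s).le (err_le ha s) hlt
  rw [limitBound, explicitBound, div_mul_div_comm]
  gcongr

lemma tendsto_add_div_add (c d : ℝ) : Tendsto (fun a : ℝ => (a + c) / (a + d)) atTop (𝓝 1) := by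
  have h1 : Tendsto (fun a : ℝ => 1 + (c - d) / (a + d)) atTop (𝓝 1) := by
    have h2 : Tendsto (fun a : ℝ => a + d) atTop atTop :=
      tendsto_atTop_add_const_right _ _ tendsto_id
    simpa using (tendsto_const_nhds.div_atTop h2).const_add (1 : ℝ)
  refine h1.congr' ?_
  filter_upwards [eventually_gt_atTop (-d)] with a ha
  have : a + d ≠ 0 := by linarith
  field_simp
  ring

lemma tendsto_limitBound : Tendsto limitBound atTop (𝓝 4) := by
  have h1 : Tendsto (fun a : ℝ => 3 / (2 * Real.pi ^ 2) / a) atTop (𝓝 0) :=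
    tendsto_const_nhds.div_atTop tendsto_id
  have h2 := (((h1.const_add 1).div (h1.const_sub 1) (by norm_num)).pow 2).const_mul 4
  have h3 := ((tendsto_add_div_add 0.177 (1 / 6)).mul (tendsto_add_div_add 0.677 (2 / 3))).sqrt
  have h4 := h2.mul h3
  norm_num at h4
  unfold limitBound
  norm_num
  exact h4

end PearsonIV

end

theorem mainTheorem4 :
    (∀ a s : ℝ, 1 ≤ a → 0 ≤ s →
      -- the bounds on the normalization constant
      (0 < PearsonIV.gammaLower a s ∧
        PearsonIV.gammaLower a s ≤ PearsonIV.gammaConst a s ∧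
        PearsonIV.gammaConst a s ≤ PearsonIV.gammaUpper a s) ∧
      -- the choice of `L` is admissible
      PearsonIV.delta a s = PearsonIV.h a s (PearsonIV.mode a s) / PearsonIV.gammaConst a s ∧
      0 < PearsonIV.chosenL a s ∧
      PearsonIV.chosenL a s ≤ PearsonIV.h a s (PearsonIV.mode a s) ∧
      (∀ x : ℝ, PearsonIV.h a s x ≤
        PearsonIV.bounding (PearsonIV.h a s) (PearsonIV.mode a s) (PearsonIV.chosenL a s) x) ∧
      -- with `L = h(m)` the expected number of iterations is 4
      PearsonIV.expectedIterations (PearsonIV.h a s) (PearsonIV.mode a s)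
          (PearsonIV.h a s (PearsonIV.mode a s)) = 4 ∧
      -- with `L = γ⁻ Δ` it is the integral of the bounding function, namely `4 γ / γ⁻`
      PearsonIV.expectedIterations (PearsonIV.h a s) (PearsonIV.mode a s)
          (PearsonIV.chosenL a s) =
        ∫⁻ x : ℝ, ENNReal.ofReal (PearsonIV.bounding (PearsonIV.h a s) (PearsonIV.mode a s)
          (PearsonIV.chosenL a s) x) ∧
      PearsonIV.expectedIterations (PearsonIV.h a s) (PearsonIV.mode a s)
          (PearsonIV.chosenL a s) =
        ENNReal.ofReal (4 * (PearsonIV.gammaConst a s / PearsonIV.gammaLower a s)) ∧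
      -- the chain of upper bounds
      4 * (PearsonIV.gammaConst a s / PearsonIV.gammaLower a s) ≤
        4 * (PearsonIV.gammaUpper a s / PearsonIV.gammaLower a s) ∧
      4 * (PearsonIV.gammaUpper a s / PearsonIV.gammaLower a s) ≤
        PearsonIV.explicitBound a s ∧
      PearsonIV.explicitBound a s ≤ PearsonIV.uniformBound) ∧
    -- the numerical value of the uniform bound
    |PearsonIV.uniformBound - 7.44| < 0.005 ∧
    -- the limit as `a → ∞`, uniformly in `s ≥ 0`
    TendstoUniformlyOn
      (fun a s : ℝ => (PearsonIV.expectedIterations (PearsonIV.h a s) (PearsonIV.mode a s)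
        (PearsonIV.chosenL a s)).toReal)
      (fun _ => 4) atTop (Set.Ici 0) := by

  refine ⟨fun a s ha hs => ?_, PearsonIV.abs_uniformBound_sub_lt, ?_⟩
  · have hlow := PearsonIV.gammaLower_pos ha s
    have hL := PearsonIV.chosenL_pos ha s
    have hLle := PearsonIV.chosenL_le ha s
    have hm := PearsonIV.h_mode_pos ha s
    have hE := PearsonIV.expectedIterations_h ha hs hL hLle
    refine ⟨⟨hlow, PearsonIV.gammaLower_le ha s, PearsonIV.le_gammaUpper ha s⟩, ?_, hL, hLle,
      PearsonIV.h_le_bounding ha hs hLle, ?_, ?_, ?_, ?_,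
      (PearsonIV.gammaUpper_div_gammaLower ha s).le, PearsonIV.explicitBound_le_uniformBound ha s⟩
    · rw [PearsonIV.h_mode, mul_div_cancel_left₀ _ (PearsonIV.gammaConst_pos ha s).ne']
    · rw [PearsonIV.expectedIterations_h ha hs hm le_rfl, div_self hm.ne']
      norm_num
    · rw [hE, PearsonIV.lintegral_bounding hm hL]
    · rw [hE, PearsonIV.h_mode_div_chosenL]
    · have := PearsonIV.le_gammaUpper ha s
      gcongr
  · rw [Metric.tendstoUniformlyOn_iff]
    intro ε hε
    filter_upwards [eventually_ge_atTop 1,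
      PearsonIV.tendsto_limitBound.eventually_lt_const (show (4 : ℝ) < 4 + ε by linarith)]
      with a ha hlt s hs
    have hg := PearsonIV.gammaConst_pos ha s
    have hlow := PearsonIV.gammaLower_pos ha s
    -- The expected number is squeezed between 4 and `limitBound a`, neither of which involves s;
    -- this is the uniformity.
    have h1 : 1 ≤ PearsonIV.gammaConst a s / PearsonIV.gammaLower a s :=
      (one_le_div hlow).mpr (PearsonIV.gammaLower_le ha s)
    have h2 : 4 * (PearsonIV.gammaConst a s / PearsonIV.gammaLower a s) ≤
        PearsonIV.limitBound a := by
      refine le_trans ?_ (PearsonIV.explicitBound_le_limitBound ha s)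
      rw [← PearsonIV.gammaUpper_div_gammaLower ha s]
      have := PearsonIV.le_gammaUpper ha s
      gcongr
    rw [PearsonIV.expectedIterations_h ha hs (PearsonIV.chosenL_pos ha s)
      (PearsonIV.chosenL_le ha s), PearsonIV.h_mode_div_chosenL,
      ENNReal.toReal_ofReal (by positivity), Real.dist_eq, abs_lt]
    constructor <;> linarith
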